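/- **Notation.** Let $N\in\{1,2,3\}$, let $D\subset\mathbb R^N$ be a bounded domain with Lipschitz boundary, and $T>0$. For $1\le r\le\infty$ put $\|v\|_{W^{1,r}(D)}=\|v\|_{L^r(D)}+\|\nabla v\|_{L^r(D)}$ and $H^1(D)=W^{1,2}(D)$; the spaces $L^r((0,T);B)$ are Bochner spaces. Let $f:\mathbb R\to\mathbb R$ be bounded and Lipschitz continuous (i.e. $f\in W^{1,\infty}(\mathbb R)$) with $f(0)=f(1)=0$ and $f(s)\ge 0$ for $0<s<1$, with Lipschitz constant $L_f$ and $|f|\le K$. Given $\alpha,\beta\in L^\infty((0,T)\times D)$, $V\in L^\infty((0,T);W^{1,\infty}(D))$ and $u^0\in L^2(D)$, a *weak solution* of $$\partial_t u+\nabla\cdot(-\nabla u+f(u)\nabla V)=\alpha f(u)-\beta u \ \text{ in }(0,T)\times D,\qquad (-\nabla u+f(u)\nabla V)\cdot n=0\ \text{ on }(0,T)\times\partial D,\qquad u(0)=u^0,$$ is a function $u\in L^2((0,T);H^1(D))$ with weak time derivative $\partial_t u\in L^2((0,T);H^1(D)^*)$ such that, for all $\varphi\in H^1(D)$ and almost every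 $t\in(0,T)$, $$\langle\partial_t u,\varphi\rangle-\int_D(-\nabla u+f(u)\nabla V)\cdot\nabla\varphi\,dx+\int_D\beta u\varphi\,dx-\int_D\alpha f(u)\varphi\,dx=0,$$ and such that $u(t)\to u^0$ in $L^2(D)$ as $t\to0^+$ (as an essential limit). **Theorem.** For $i=1,2$ let $u_i$ be a weak solution for the data $(\alpha_i,\beta_i,V_i,u_i^0)$, where $\alpha_i,\beta_i\in L^\infty((0,T)\times D)$ are each bounded below almost everywhere by a positive constant, $V_i\in L^\infty((0,T);W^{1,\infty}(D))$, and $u_i^0\in W^{2-2/p,p}(D)$ for some fixed $2<p<3$, with $0\le u_i^0\le1$ almost everywhere. Let $M$ be a number with $\|V_1\|_{L^\infty((0,T);W^{1,\infty}(D))}\le M$, $\|\alpha_2\|_{L^\infty((0,T)\times D)}\le M$ and $\|\beta_2\|_{L^\infty((0,T)\times D)}\le M$. Then $$\|u_1-u_2\|_{L^2((0,T);H^1(D))}^2\le C e^{\tilde C T}\Bigl(\|\alpha_1-\alpha_2\|_{L^\infty((0,T)\times D)}^2+\|\beta_1-\beta_2\|_{L^\infty((0,T)\times D)}^2+\|V_1-V_2\|_{L^\infty((0,T);W^{1,\infty}(D))}^2+\|u_1^0-u_2^0\|_{L^2(D)}^2\Bigr),$$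 with constants $\tilde C>0$ depending only on $L_f$ and $M$, and $C>0$ depending only on $L_f$, $M$, $D$ and $K$; in particular neither depends on $T$. -/

import Mathlib

open MeasureTheory Set Filter Topology
open scoped NNReal ENNReal ContDiff InnerProductSpace

noncomputable section

namespace ConvDiff

/-- `ℝᴺ` with the Euclidean norm and inner product. -/
abbrev Space (N : ℕ) : Type := EuclideanSpace ℝ (Fin N)

/-- `D ⊆ ℝᴺ` is a bounded domain (open, connected, nonempty) with Lipschitz boundary: near every
boundary point `x`, and for a suitable unit vector `e`, the set `D` is the part of `ℝᴺ` lying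
strictly above the graph of a Lipschitz function `γ` of the coordinates orthogonal to `e`. -/
structure IsBoundedLipschitzDomain {N : ℕ} (D : Set (Space N)) : Prop where
  isOpen : IsOpen D
  isConnected : IsConnected D
  isBounded : Bornology.IsBounded D
  lipschitz_boundary : ∀ x ∈ frontier D, ∃ e : Space N, ‖e‖ = 1 ∧
    ∃ (γ : Space N → ℝ) (κ : ℝ≥0), LipschitzWith κ γ ∧
      ∃ U ∈ 𝓝 x, ∀ y ∈ U, y ∈ D ↔ γ (y - ⟪e, y⟫_ℝ • e) < ⟪e, y⟫_ℝ

/-- Lebesgue measure on `D`. -/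
abbrev vol {N : ℕ} (D : Set (Space N)) : Measure (Space N) := volume.restrict D

/-- Lebesgue measure on the time interval `(0,T)`. -/
abbrev timeVol (T : ℝ) : Measure ℝ := volume.restrict (Ioo 0 T)

/-- Lebesgue measure on the space-time cylinder `(0,T) × D`. -/
abbrev cylVol {N : ℕ} (T : ℝ) (D : Set (Space N)) : Measure (ℝ × Space N) :=
  volume.restrict (Ioo 0 T ×ˢ D)

/-- The vector field `G` is the weak gradient of `u` on `D`. -/
def IsWeakGradient {N : ℕ} (D : Set (Space N)) (u : Space N → ℝ) (G : Space N → Space N) : Prop :=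
  LocallyIntegrableOn u D ∧ LocallyIntegrableOn G D ∧
    ∀ φ : Space N → ℝ, ContDiff ℝ ∞ φ → HasCompactSupport φ → tsupport φ ⊆ D →
      ∫ x in D, u x • gradient φ x = - ∫ x in D, φ x • G x

theorem locallyIntegrableOn_of_Lp {N : ℕ} {D : Set (Space N)} {p : ℝ≥0∞} [Fact (1 ≤ p)]
    {F : Type*} [NormedAddCommGroup F] (u : Lp F p (vol D)) : LocallyIntegrableOn u D :=
  locallyIntegrableOn_of_locallyIntegrable_restrict
    ((Lp.memLp u).locallyIntegrable Fact.out)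

theorem continuous_gradient {N : ℕ} {φ : Space N → ℝ} (hφ : ContDiff ℝ ∞ φ) :
    Continuous (gradient φ) :=
  (InnerProductSpace.toDual ℝ (Space N)).symm.continuous.comp (hφ.continuous_fderiv (by simp))

theorem hasCompactSupport_gradient {N : ℕ} {φ : Space N → ℝ} (hφ : HasCompactSupport φ) :
    HasCompactSupport (gradient φ) :=
  (hφ.fderiv (𝕜 := ℝ)).comp_left (g := (InnerProductSpace.toDual ℝ (Space N)).symm) (map_zero _)

theorem integrable_smul_gradient {N : ℕ} {D : Set (Space N)} {p : ℝ≥0∞} [Fact (1 ≤ p)]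
    (u : Lp ℝ p (vol D)) {φ : Space N → ℝ} (hφ : ContDiff ℝ ∞ φ) (hc : HasCompactSupport φ) :
    Integrable (fun x => u x • gradient φ x) (vol D) :=
  ((Lp.memLp u).locallyIntegrable Fact.out).integrable_smul_right_of_hasCompactSupport
    (continuous_gradient hφ) (hasCompactSupport_gradient hc)

theorem integrable_smul_field {N : ℕ} {D : Set (Space N)} {p : ℝ≥0∞} [Fact (1 ≤ p)]
    (G : Lp (Space N) p (vol D)) {φ : Space N → ℝ} (hφ : ContDiff ℝ ∞ φ)
    (hc : HasCompactSupport φ) : Integrable (fun x => φ x • G x) (vol D) :=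
  ((Lp.memLp G).locallyIntegrable Fact.out).integrable_smul_left_of_hasCompactSupport
    hφ.continuous hc

/-- The Sobolev space `W^{1,p}(D)`, `1 ≤ p ≤ ∞`: the pairs `(u, ∇u)` with `u ∈ Lᵖ(D)` and weak
gradient `∇u ∈ Lᵖ(D; ℝᴺ)`. The `ℓ¹` product supplies the norm
`‖u‖_{W^{1,p}} = ‖u‖_{Lᵖ} + ‖∇u‖_{Lᵖ}`. -/
def W1 {N : ℕ} (D : Set (Space N)) (p : ℝ≥0∞) [Fact (1 ≤ p)] :
    Submodule ℝ (WithLp 1 (Lp ℝ p (vol D) × Lp (Space N) p (vol D))) where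
  carrier := {v | IsWeakGradient D v.fst v.snd}
  zero_mem' := by
    refine ⟨locallyIntegrableOn_of_Lp _, locallyIntegrableOn_of_Lp _, fun φ _ _ _ => ?_⟩
    have h1 : (fun x => (0 : Lp ℝ p (vol D)) x • gradient φ x) =ᵐ[vol D] fun _ => 0 := by
      filter_upwards [Lp.coeFn_zero ℝ p (vol D)] with x hx
      rw [hx, Pi.zero_apply, zero_smul]
    have h2 : (fun x => φ x • (0 : Lp (Space N) p (vol D)) x) =ᵐ[vol D] fun _ => 0 := by
      filter_upwards [Lp.coeFn_zero (Space N) p (vol D)] with x hx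
      rw [hx, Pi.zero_apply, smul_zero]
    simp only [WithLp.zero_fst, WithLp.zero_snd]
    rw [integral_congr_ae h1, integral_congr_ae h2]
    simp
  add_mem' := by
    intro v w hv hw
    refine ⟨locallyIntegrableOn_of_Lp _, locallyIntegrableOn_of_Lp _, fun φ h1 h2 h3 => ?_⟩
    have e1 : (fun x => (v.fst + w.fst) x • gradient φ x) =ᵐ[vol D]
        fun x => v.fst x • gradient φ x + w.fst x • gradient φ x := by
      filter_upwards [Lp.coeFn_add v.fst w.fst] with x hx
      rw [hx, Pi.add_apply, add_smul]
    have e2 : (fun x => φ x • (v.snd + w.snd) x) =ᵐ[vol D]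
        fun x => φ x • v.snd x + φ x • w.snd x := by
      filter_upwards [Lp.coeFn_add v.snd w.snd] with x hx
      rw [hx, Pi.add_apply, smul_add]
    simp only [WithLp.add_fst, WithLp.add_snd]
    rw [integral_congr_ae e1, integral_congr_ae e2,
      integral_add (integrable_smul_gradient _ h1 h2) (integrable_smul_gradient _ h1 h2),
      integral_add (integrable_smul_field _ h1 h2) (integrable_smul_field _ h1 h2),
      hv.2.2 φ h1 h2 h3, hw.2.2 φ h1 h2 h3, neg_add]
  smul_mem' := by
    intro c v hv
    refine ⟨locallyIntegrableOn_of_Lp _, locallyIntegrableOn_of_Lp _, fun φ h1 h2 h3 => ?_⟩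
    have e1 : (fun x => (c • v.fst) x • gradient φ x) =ᵐ[vol D]
        fun x => c • (v.fst x • gradient φ x) := by
      filter_upwards [Lp.coeFn_smul c v.fst] with x hx
      rw [hx, Pi.smul_apply, smul_assoc]
    have e2 : (fun x => φ x • (c • v.snd) x) =ᵐ[vol D] fun x => c • (φ x • v.snd x) := by
      filter_upwards [Lp.coeFn_smul c v.snd] with x hx
      rw [hx, Pi.smul_apply, smul_comm]
    simp only [WithLp.smul_fst, WithLp.smul_snd]
    rw [integral_congr_ae e1, integral_congr_ae e2, integral_smul, integral_smul,
      hv.2.2 φ h1 h2 h3, smul_neg]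

/-- The function underlying an element of `W^{1,p}(D)`. -/
def fn {N : ℕ} {D : Set (Space N)} {p : ℝ≥0∞} [Fact (1 ≤ p)] (v : W1 D p) :
    Lp ℝ p (vol D) := v.1.fst

/-- The weak gradient of an element of `W^{1,p}(D)`. -/
def grad {N : ℕ} {D : Set (Space N)} {p : ℝ≥0∞} [Fact (1 ≤ p)] (v : W1 D p) :
    Lp (Space N) p (vol D) := v.1.snd

/-- `H¹(D) = W^{1,2}(D)`. -/
abbrev H1 {N : ℕ} (D : Set (Space N)) : Type := W1 D 2

/-- `u ∈ W^{1+σ,p}(D)` for `0 < σ < 1` and `1 ≤ p < ∞` (Sobolev–Slobodeckij space): `u` and its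
weak gradient are in `Lᵖ(D)`, and the gradient has finite Gagliardo seminorm of order `σ`. -/
def MemSlobodeckij {N : ℕ} (D : Set (Space N)) (σ p : ℝ) (u : Space N → ℝ) : Prop :=
  MemLp u (ENNReal.ofReal p) (vol D) ∧
    ∃ G : Space N → Space N, IsWeakGradient D u G ∧ MemLp G (ENNReal.ofReal p) (vol D) ∧
      ∫⁻ x in D, ∫⁻ y in D,
        ENNReal.ofReal (‖G x - G y‖ ^ p / ‖x - y‖ ^ ((N : ℝ) + σ * p)) < ⊤

/-- Admissible initial data: `u⁰ ∈ W^{2-2/p,p}(D)` and `0 ≤ u⁰ ≤ 1` almost everywhere. -/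
structure IsAdmissibleInitial {N : ℕ} (D : Set (Space N)) (p : ℝ) (u₀ : Lp ℝ 2 (vol D)) :
    Prop where
  regular : MemSlobodeckij D (1 - 2 / p) p u₀
  nonneg : ∀ᵐ x ∂(vol D), 0 ≤ u₀ x
  le_one : ∀ᵐ x ∂(vol D), u₀ x ≤ 1

/-- The function `a ∈ L^∞((0,T) × D)` is bounded below by a positive constant. -/
def IsUniformlyPositive {N : ℕ} {T : ℝ} {D : Set (Space N)} (a : Lp ℝ ∞ (cylVol T D)) : Prop :=
  ∃ a₀ : ℝ, 0 < a₀ ∧ ∀ᵐ z ∂(cylVol T D), a₀ ≤ a z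

/-- `f ∈ W^{1,∞}(ℝ)`, i.e. `f` is bounded (by `K`) and Lipschitz (with constant `L`), with
`f(0) = f(1) = 0` and `f ≥ 0` on `(0,1)`. -/
structure IsAdmissibleMobility (L : ℝ≥0) (K : ℝ) (f : ℝ → ℝ) : Prop where
  bounded : ∀ s, |f s| ≤ K
  lipschitz : LipschitzWith L f
  zero : f 0 = 0
  one : f 1 = 0
  nonneg : ∀ s, 0 < s → s < 1 → 0 ≤ f s

/-- `w ∈ L²((0,T); H¹(D)*)` is the weak time derivative `∂ₜu` of `u ∈ L²((0,T); H¹(D))`, where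
`H¹(D) ⊆ L²(D) ⊆ H¹(D)*` through the inner product of `L²(D)`. -/
def IsTimeDerivative {N : ℕ} {D : Set (Space N)} {T : ℝ} (u : Lp (H1 D) 2 (timeVol T))
    (w : Lp (H1 D →L[ℝ] ℝ) 2 (timeVol T)) : Prop :=
  ∀ φ : H1 D, ∀ η : ℝ → ℝ, ContDiff ℝ ∞ η → HasCompactSupport η → tsupport η ⊆ Ioo 0 T →
    ∫ t in Ioo 0 T, deriv η t * (∫ x in D, fn (u t) x * fn φ x)
      = - ∫ t in Ioo 0 T, η t * w t φ

/-- `u` is a weak solution of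
`∂ₜu + ∇·(-∇u + f(u)∇V) = α f(u) - β u` in `(0,T) × D`,
`(-∇u + f(u)∇V)·n = 0` on `(0,T) × ∂D`, `u(0) = u⁰`.
The initial value is attained in `L²(D)`, as the essential limit of `u(t)` for `t → 0⁺`; this is
the value at `0` of the representative of `u` in `C([0,T]; L²(D))`. -/
structure IsWeakSolution {N : ℕ} {D : Set (Space N)} {T : ℝ} (f : ℝ → ℝ)
    (α β : Lp ℝ ∞ (cylVol T D)) (V : Lp (W1 D ∞) ∞ (timeVol T)) (u₀ : Lp ℝ 2 (vol D))
    (u : Lp (H1 D) 2 (timeVol T)) : Prop where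
  weak_form : ∃ w : Lp (H1 D →L[ℝ] ℝ) 2 (timeVol T), IsTimeDerivative u w ∧
    ∀ φ : H1 D, ∀ᵐ t ∂(timeVol T),
      w t φ
        - (∫ x in D, ⟪-grad (u t) x + f (fn (u t) x) • grad (V t) x, grad φ x⟫_ℝ)
        + (∫ x in D, β (t, x) * fn (u t) x * fn φ x)
        - (∫ x in D, α (t, x) * f (fn (u t) x) * fn φ x) = 0
  initial : Tendsto (fun t => fn (u t)) (ae (timeVol T) ⊓ 𝓝 0) (𝓝 u₀)

end ConvDiff

end

open ConvDiff

/-! The difference v = u₁ - u₂ is itself used as test function. The flux and reaction differences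
are split so that only V₁ and α₂ need bounds, β₁ enters through a term of good sign, and everything
else is a difference of data times f (bounded by K), f(u₁) - f(u₂) (Lipschitz), or u₂. Young's
inequality absorbs the gradients, and Grönwall's inequality closes the estimate
(`two_mul_difference_density_le`, `parabolic_energy_estimate`).

Testing with v requires ‖v(τ)‖² - ‖v(s)‖² ≤ 2∫⟨∂ₜv, v⟩ when ∂ₜv is only dual-valued.
`exists_energy_inequality` proves this without mollification: the elementary bound ‖v(t)‖² -
‖v(t-h)‖² ≤ 2⟨v(t) - v(t-h), v(t)⟩ turns the right side into an average of ∂ₜv over (t-h, t) paired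
with v(t). Integrating in t, dividing by h and letting h → 0⁺, continuity of translations in L²
identifies the limit.

The term (β₁ - β₂)u₂v brings in the L² norm of u₂. It is bounded by the energy estimate for one
solution (`IsWeakSolution.energy_estimate`), not by a maximum principle, and that bound involves V₂,
which M does not control. If ‖V₁ - V₂‖ ≤ 1, then V₂ is controlled after all. Otherwise the
right-hand side of the theorem is already large, and the separate energy bounds of u₁ and u₂
suffice. The growth in T stays inside the exponential because the Grönwall rate is at least 1. -/

/-! ### Weak derivatives in time: du Bois-Reymond and integration by parts. -/

section Abstract

variable {F : Type*} [NormedAddCommGroup F] [NormedSpace ℝ F]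

/-- A smooth function supported in `(0,T)` with integral zero is the derivative of a smooth
function supported in `(0,T)`. -/
theorem exists_primitive_of_integral_eq_zero {T : ℝ} {θ : ℝ → ℝ} (hθ : ContDiff ℝ ∞ θ)
    (hc : HasCompactSupport θ) (hs : tsupport θ ⊆ Ioo 0 T) (h0 : ∫ t, θ t = 0) :
    ∃ η : ℝ → ℝ, ContDiff ℝ ∞ η ∧ HasCompactSupport η ∧ tsupport η ⊆ Ioo 0 T ∧
      deriv η = θ := by
  have hderiv : ∀ t, HasDerivAt (fun t => ∫ s in (0 : ℝ)..t, θ s) (θ t) t := fun t =>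
    intervalIntegral.integral_hasDerivAt_right (hθ.continuous.intervalIntegrable _ _)
      hθ.continuous.aestronglyMeasurable.stronglyMeasurableAtFilter hθ.continuous.continuousAt
  have hd : deriv (fun t => ∫ s in (0 : ℝ)..t, θ s) = θ := funext fun t => (hderiv t).deriv
  obtain ⟨a, b, ha, hab, hsub⟩ : ∃ a b : ℝ, 0 < a ∧ b < T ∧ tsupport θ ⊆ Icc a b := by
    rcases (tsupport θ).eq_empty_or_nonempty with he | hne
    -- With empty support any a > 0 and b < T will do; `Icc a b` may be empty.
    · exact ⟨1, T - 1, one_pos, by linarith, by simp [he]⟩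
    · obtain ⟨a, ha, ha'⟩ := hc.isCompact.exists_isLeast hne
      obtain ⟨b, hb, hb'⟩ := hc.isCompact.exists_isGreatest hne
      exact ⟨a, b, (hs ha).1, (hs hb).2, fun x hx => ⟨ha' hx, hb' hx⟩⟩
  have hzero : ∀ x, x ∉ Icc a b → θ x = 0 := fun x hx => image_eq_zero_of_notMem_tsupport
    fun h => hx (hsub h)
  have hη0 : ∀ t, t ∉ Icc a b → ∫ s in (0 : ℝ)..t, θ s = 0 := by
    intro t ht
    by_cases hta : t < a
    · rw [intervalIntegral.integral_congr (g := fun _ => 0)]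
      · simp
      · intro s hs'
        refine hzero s fun h => ?_
        have := (mem_uIcc.1 hs')
        have h1 := h.1
        rcases this with h' | h' <;> linarith [h'.1, h'.2]
    · have htb : b < t := by
        by_contra hcon
        exact ht ⟨not_lt.1 hta, not_lt.1 hcon⟩
      by_cases h0t : 0 ≤ t
      -- To the right of the support the primitive equals the full integral; this is where mean zero
      -- is needed.
      · rw [intervalIntegral.integral_of_le h0t, ← h0]
        refine setIntegral_eq_integral_of_forall_compl_eq_zero fun x hx => hzero x fun h => hx ?_
        exact ⟨by linarith [h.1], by linarith [h.2]⟩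
      · exact absurd ha (by linarith)
  have hsupp : tsupport (fun t => ∫ s in (0 : ℝ)..t, θ s) ⊆ Icc a b :=
    closure_minimal (fun t ht => by_contra fun h => ht (hη0 t h)) isClosed_Icc
  refine ⟨_, ?_, isCompact_Icc.of_isClosed_subset (isClosed_tsupport _) hsupp,
    hsupp.trans fun x hx => ⟨ha.trans_le hx.1, hx.2.trans_lt hab⟩, hd⟩
  rw [contDiff_infty_iff_deriv, hd]
  exact ⟨fun t => (hderiv t).differentiableAt, hθ⟩

theorem LocallyIntegrableOn.ae_eq_zero_of_test {f : ℝ → F} {T : ℝ} [CompleteSpace F]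
    (hf : LocallyIntegrableOn f (Ioo 0 T))
    (h : ∀ g : ℝ → ℝ, ContDiff ℝ ∞ g → HasCompactSupport g → tsupport g ⊆ Ioo 0 T →
      ∫ x, g x • f x = 0) : ∀ᵐ x ∂volume.restrict (Ioo 0 T), f x = 0 := by
  rw [ae_restrict_iff' measurableSet_Ioo]
  exact isOpen_Ioo.ae_eq_zero_of_integral_contDiff_smul_eq_zero hf h

theorem integral_smul_restrict_of_tsupport_subset {f : ℝ → F} {g : ℝ → ℝ} {s : Set ℝ}
    (hg : tsupport g ⊆ s) : ∫ t in s, g t • f t = ∫ t, g t • f t :=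
  setIntegral_eq_integral_of_forall_compl_eq_zero fun x hx => by
    rw [image_eq_zero_of_notMem_tsupport fun h => hx (hg h), zero_smul]

theorem integrableOn_smul_of_test {f : ℝ → F} {g : ℝ → ℝ} {s : Set ℝ} (hf : IntegrableOn f s)
    (hg : Continuous g) (hc : HasCompactSupport g) : IntegrableOn (fun t => g t • f t) s := by
  obtain ⟨C, hC⟩ := hc.exists_bound_of_continuous hg
  exact Integrable.bdd_smul hf C hg.aestronglyMeasurable (ae_of_all _ hC)

/-- The du Bois-Reymond lemma: a function on `(0,T)` with vanishing weak derivative is constant. -/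
theorem ae_eq_const_of_integral_deriv_smul_eq_zero [CompleteSpace F] {T : ℝ} (hT : 0 < T)
    {f : ℝ → F} (hf : IntegrableOn f (Ioo 0 T))
    (h : ∀ η : ℝ → ℝ, ContDiff ℝ ∞ η → HasCompactSupport η → tsupport η ⊆ Ioo 0 T →
      ∫ t in Ioo 0 T, deriv η t • f t = 0) :
    ∃ c : F, ∀ᵐ t ∂volume.restrict (Ioo 0 T), f t = c := by
  let ψ : ContDiffBump (T / 2) := ⟨T / 8, T / 4, by linarith, by linarith⟩
  set ρ : ℝ → ℝ := ψ.normed volume with hρ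
  have hρ1 : ContDiff ℝ ∞ ρ := ψ.contDiff_normed
  have hρ2 : HasCompactSupport ρ := ψ.hasCompactSupport_normed
  have hρ3 : tsupport ρ ⊆ Ioo 0 T := by
    rw [hρ, ψ.tsupport_normed_eq, Real.closedBall_eq_Icc]
    intro x hx
    have : ψ.rOut = T / 4 := rfl
    rw [this] at hx
    exact ⟨by linarith [hx.1], by linarith [hx.2]⟩
  set c : F := ∫ t in Ioo 0 T, ρ t • f t with hcdef
  refine ⟨c, ?_⟩
  have hfc : IntegrableOn (fun t => f t - c) (Ioo 0 T) := hf.sub (by simp)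
  have key := LocallyIntegrableOn.ae_eq_zero_of_test hfc.locallyIntegrableOn fun g hg hgc hgs => ?_
  · filter_upwards [key] with t ht using sub_eq_zero.1 ht
  -- Removing the mean of g with the unit-mass bump ρ makes θ the derivative of a test function. The
  -- hypothesis then says that g integrates f to (∫ g)·c, with c the ρ-weighted mean of f.
  set θ : ℝ → ℝ := fun t => g t - (∫ s, g s) * ρ t with hθ
  have hθs : tsupport θ ⊆ Ioo 0 T := by
    refine (tsupport_sub (f := g) (g := fun t => (∫ s, g s) * ρ t)).trans (union_subset hgs ?_)
    exact (tsupport_mul_subset_right (f := fun _ => ∫ s, g s)).trans hρ3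
  have hθ0 : ∫ t, θ t = 0 := by
    rw [hθ, integral_sub (hg.continuous.integrable_of_hasCompactSupport hgc)
      ((hρ1.continuous.integrable_of_hasCompactSupport hρ2).const_mul _), integral_const_mul,
      hρ, ψ.integral_normed, mul_one, sub_self]
  have hθc : HasCompactSupport θ := hgc.sub (hρ2.mul_left (f := fun _ => ∫ s, g s))
  obtain ⟨η, h1, h2, h3, h4⟩ := exists_primitive_of_integral_eq_zero
    (hg.sub (contDiff_const.mul hρ1)) hθc hθs hθ0
  have h5 := h η h1 h2 h3
  rw [h4] at h5
  have e1 : ∀ t, θ t • f t = g t • f t - (∫ s, g s) • (ρ t • f t) := fun t => by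
    rw [hθ, sub_smul, mul_smul]
  have iρ : IntegrableOn (fun t => (∫ s, g s) • (ρ t • f t)) (Ioo 0 T) :=
    (integrableOn_smul_of_test hf hρ1.continuous hρ2).smul (∫ s, g s)
  have ig := integrableOn_smul_of_test hf hg.continuous hgc
  have ic : IntegrableOn (fun t => g t • c) (Ioo 0 T) :=
    integrableOn_smul_of_test (by simp) hg.continuous hgc
  rw [integral_congr_ae (ae_of_all _ e1), integral_sub ig iρ, integral_smul, ← hcdef] at h5
  have hgi : ∫ t in Ioo 0 T, g t = ∫ t, g t := by
    simpa using integral_smul_restrict_of_tsupport_subset (f := fun _ : ℝ => (1 : ℝ)) hgs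
  rw [← integral_smul_restrict_of_tsupport_subset hgs]
  simp only [smul_sub]
  rw [integral_sub ig ic, integral_smul_const, hgi]
  exact h5

/-- Integration by parts for the primitive of an integrable function. -/
theorem integral_deriv_mul_primitive {T : ℝ} (hT : 0 < T) {b : ℝ → ℝ}
    (hb : IntegrableOn b (Ioo 0 T)) {η : ℝ → ℝ} (h1 : ContDiff ℝ ∞ η) (h2 : HasCompactSupport η)
    (h3 : tsupport η ⊆ Ioo 0 T) :
    ∫ t in Ioo 0 T, deriv η t * ∫ s in (0 : ℝ)..t, b s = - ∫ t in Ioo 0 T, η t * b t := by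
  have hbi : IntervalIntegrable b volume 0 T := by
    rwa [intervalIntegrable_iff_integrableOn_Ioo_of_le hT.le]
  have hη : AbsolutelyContinuousOnInterval η 0 T := by
    obtain ⟨C, hC⟩ := h1.lipschitzWith_of_hasCompactSupport h2 (by simp)
    exact hC.lipschitzOnWith.absolutelyContinuousOnInterval
  have hB := hbi.absolutelyContinuousOnInterval_intervalIntegral (c := 0) (by simp)
  have := hη.integral_mul_deriv_eq_deriv_mul hB
  have z0 : η T = 0 := image_eq_zero_of_notMem_tsupport fun h => lt_irrefl _ (h3 h).2
  have z1 : η 0 = 0 := image_eq_zero_of_notMem_tsupport fun h => lt_irrefl _ (h3 h).1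
  rw [z0, z1, zero_mul, zero_mul, sub_zero, zero_sub, ← neg_eq_iff_eq_neg,
    intervalIntegral.integral_of_le hT.le, intervalIntegral.integral_of_le hT.le,
    integral_Ioc_eq_integral_Ioo, integral_Ioc_eq_integral_Ioo] at this
  rw [← this]
  congr 1
  refine integral_congr_ae ?_
  rw [EventuallyEq, ae_restrict_iff' measurableSet_Ioo]
  filter_upwards [hbi.ae_hasDerivAt_integral] with t ht h
  rw [(ht (by rw [uIcc_of_le hT.le]; exact Ioo_subset_Icc_self h) 0 (by simp)).deriv]

end Abstract

/-! ### Dual-valued time derivatives over a pivot space. -/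

section Gelfand

variable {H E : Type*} [NormedAddCommGroup H] [NormedSpace ℝ H]
  [NormedAddCommGroup E] [InnerProductSpace ℝ E]

/-- The map `H → H*` induced by a continuous map of `H` into a pivot inner product space. -/
noncomputable def pivotMap (ι : H →L[ℝ] E) : H →L[ℝ] (H →L[ℝ] ℝ) :=
  ((ContinuousLinearMap.compL ℝ H E ℝ).flip ι) ∘L (innerSL ℝ) ∘L ι

theorem pivotMap_apply (ι : H →L[ℝ] E) (x y : H) : pivotMap ι x y = ⟪ι x, ι y⟫_ℝ := rfl

/-- A function with an integrable weak derivative in the dual space is, up to a constant, the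
primitive of that derivative. -/
theorem exists_ae_eq_const_add_primitive {T : ℝ} (hT : 0 < T) {J w : ℝ → (H →L[ℝ] ℝ)}
    (hJ : IntegrableOn J (Ioo 0 T)) (hw : IntegrableOn w (Ioo 0 T))
    (h : ∀ φ : H, ∀ η : ℝ → ℝ, ContDiff ℝ ∞ η → HasCompactSupport η → tsupport η ⊆ Ioo 0 T →
      ∫ t in Ioo 0 T, deriv η t * J t φ = - ∫ t in Ioo 0 T, η t * w t φ) :
    ∃ c : H →L[ℝ] ℝ, ∀ᵐ t ∂volume.restrict (Ioo 0 T), J t = c + ∫ s in (0 : ℝ)..t, w s := by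
  have hwi : ∀ t ∈ Icc 0 T, IntervalIntegrable w volume 0 t := fun t ht => by
    rw [intervalIntegrable_iff_integrableOn_Ioo_of_le ht.1]
    exact hw.mono_set (Ioo_subset_Ioo_right ht.2)
  have hcont : ContinuousOn (fun t => ∫ s in (0 : ℝ)..t, w s) (Icc 0 T) := by
    have := intervalIntegral.continuousOn_primitive_interval (f := w) (μ := volume) (a := 0) (b := T)
      (by rw [uIcc_of_le hT.le, integrableOn_Icc_iff_integrableOn_Ioo]; exact hw)
    rwa [uIcc_of_le hT.le] at this
  have hWint : IntegrableOn (fun t => ∫ s in (0 : ℝ)..t, w s) (Ioo 0 T) :=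
    hcont.integrableOn_Icc.mono_set Ioo_subset_Icc_self
  -- Subtracting the primitive of w leaves a function with zero weak derivative, so du Bois-Reymond
  -- applies.
  suffices h0 : ∀ η : ℝ → ℝ, ContDiff ℝ ∞ η → HasCompactSupport η → tsupport η ⊆ Ioo 0 T →
      ∫ t in Ioo 0 T, deriv η t • (J - fun t => ∫ s in (0 : ℝ)..t, w s) t = 0 by
    obtain ⟨c, hc⟩ := ae_eq_const_of_integral_deriv_smul_eq_zero hT (hJ.sub hWint) h0
    refine ⟨c, ?_⟩
    filter_upwards [hc] with t ht
    rw [← ht]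
    simp
  intro η h1 h2 h3
  have hd1 : Continuous (deriv η) := h1.continuous_deriv (by simp)
  have hd2 : HasCompactSupport (deriv η) := h2.deriv
  have i1 := integrableOn_smul_of_test (hJ.sub hWint) hd1 hd2
  ext φ
  rw [ContinuousLinearMap.integral_apply i1]
  have iw : IntegrableOn (fun t => w t φ) (Ioo 0 T) := hw.apply_continuousLinearMap φ
  have iJ := integrableOn_smul_of_test (hJ.apply_continuousLinearMap φ) hd1 hd2
  have iW := integrableOn_smul_of_test (hWint.apply_continuousLinearMap φ) hd1 hd2
  have e : ∀ t, (deriv η t • (J - fun t => ∫ s in (0 : ℝ)..t, w s) t) φ =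
      deriv η t • J t φ - deriv η t • (∫ s in (0 : ℝ)..t, w s) φ := fun t => by
    simp [mul_sub]
  simp only [e]
  rw [integral_sub iJ iW]
  have e2 : ∫ t in Ioo 0 T, deriv η t • (∫ s in (0 : ℝ)..t, w s) φ =
      ∫ t in Ioo 0 T, deriv η t * ∫ s in (0 : ℝ)..t, w s φ := by
    refine setIntegral_congr_fun measurableSet_Ioo fun t ht => ?_
    simp only [smul_eq_mul]
    rw [ContinuousLinearMap.intervalIntegral_apply (hwi t (Ioo_subset_Icc_self ht))]
  rw [e2, integral_deriv_mul_primitive hT iw h1 h2 h3]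
  simp only [smul_eq_mul]
  rw [h φ η h1 h2 h3]
  simp

/-- The pairing of a translated square integrable dual-valued function with a square integrable
function depends continuously on the translation. -/
theorem continuous_integral_translate_apply {w : ℝ → (H →L[ℝ] ℝ)} {V : ℝ → H}
    (hw : MemLp w 2) (hV : MemLp V 2) : Continuous fun r => ∫ t, w (t - r) (V t) := by
  have : Fact ((2 : ℝ≥0∞) ≠ ⊤) := ⟨ENNReal.ofNat_ne_top⟩
  let B : (H →L[ℝ] ℝ) →L[ℝ] H →L[ℝ] ℝ := ContinuousLinearMap.id ℝ _
  -- The integral is the L² pairing of V with a translate of w, and the translation action on L² is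
  -- strongly continuous.
  have key : ∀ r, ∫ t, w (t - r) (V t) =
      B.lpPairing volume 2 2 (DomAddAct.mk (-r) +ᵥ hw.toLp w) (hV.toLp V) := fun r => by
    rw [ContinuousLinearMap.lpPairing_eq_integral, DomAddAct.mk_vadd_toLp]
    refine integral_congr_ae ?_
    filter_upwards [MemLp.coeFn_toLp (hw.comp_measurePreserving (measurePreserving_vadd (-r) volume)),
      hV.coeFn_toLp] with t h1 h2
    change _ = B (MemLp.toLp (w ∘ fun x => -r +ᵥ x) _ t) _
    rw [h1, h2]
    simp [B, sub_eq_neg_add]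
  simp_rw [key]
  have h1 : Continuous fun r : ℝ => DomAddAct.mk (-r) +ᵥ hw.toLp w := by
    have : Continuous fun r : ℝ => DomAddAct.mk (-r) :=
      DomAddAct.continuous_mk.comp continuous_neg
    exact continuous_vadd.comp (this.prodMk continuous_const)
  fun_prop

end Gelfand

/-! ### The energy inequality by backward difference quotients. -/

section Energy

variable {H E : Type*} [NormedAddCommGroup H] [NormedSpace ℝ H]
  [NormedAddCommGroup E] [InnerProductSpace ℝ E]

theorem memLp_indicator_of_restrict {F : Type*} [NormedAddCommGroup F] {s : Set ℝ} {w : ℝ → F}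
    (hs : MeasurableSet s) (hw : MemLp w 2 (volume.restrict s)) : MemLp (s.indicator w) 2 volume :=
  (memLp_indicator_iff_restrict hs).2 hw

theorem integrable_indicator_of_integrableOn {F : Type*} [NormedAddCommGroup F] {s : Set ℝ}
    {w : ℝ → F} (hs : MeasurableSet s) (hw : IntegrableOn w s) : Integrable (s.indicator w) :=
  (integrable_indicator_iff hs).2 hw

/-- Averaging the pairing over translations, by Fubini. -/
theorem integral_integral_translate_apply {w : ℝ → (H →L[ℝ] ℝ)} {V : ℝ → H}
    (hw : Integrable w) (hV : Integrable V) (h : ℝ) (hh : 0 ≤ h) :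
    Integrable (fun t => ∫ r in (0 : ℝ)..h, w (t - r) (V t)) ∧
    ∫ t, ∫ r in (0 : ℝ)..h, w (t - r) (V t) = ∫ r in (0 : ℝ)..h, ∫ t, w (t - r) (V t) := by
  let B : H →L[ℝ] (H →L[ℝ] ℝ) →L[ℝ] ℝ := (ContinuousLinearMap.id ℝ (H →L[ℝ] ℝ)).flip
  -- After reflecting w, the double integrand is that of a convolution, hence integrable on the
  -- product.
  have hw' : Integrable fun t => w (-t) := hw.comp_neg
  have h1 : Integrable (fun p : ℝ × ℝ => w (p.2 - p.1) (V p.2))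
      ((volume.restrict (Ioc 0 h)).prod volume) := by
    have := Integrable.convolution_integrand (μ := volume) (ν := volume) B hV hw'
    refine (this.mono_measure ?_).congr (ae_of_all _ fun p => ?_)
    · exact Measure.prod_mono Measure.restrict_le_self le_rfl
    · simp [B]
  simp only [intervalIntegral.integral_of_le hh]
  exact ⟨h1.integral_prod_right, (integral_integral_swap h1).symm⟩

/-- The energy inequality for a function with square integrable weak time derivative in the
dual space. -/
theorem exists_energy_inequality (ι : H →L[ℝ] E) {T : ℝ} (hT : 0 < T) {v : ℝ → H}
    {w : ℝ → (H →L[ℝ] ℝ)} (hv : MemLp v 2 (volume.restrict (Ioo 0 T)))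
    (hw : MemLp w 2 (volume.restrict (Ioo 0 T)))
    (h : ∀ φ : H, ∀ η : ℝ → ℝ, ContDiff ℝ ∞ η → HasCompactSupport η → tsupport η ⊆ Ioo 0 T →
      ∫ t in Ioo 0 T, deriv η t * ⟪ι (v t), ι φ⟫_ℝ = - ∫ t in Ioo 0 T, η t * w t φ) :
    ∃ S : Set ℝ, (∀ᵐ t ∂volume.restrict (Ioo 0 T), t ∈ S) ∧ ∀ s ∈ S, ∀ τ ∈ S, s < τ →
      ‖ι (v τ)‖ ^ 2 - ‖ι (v s)‖ ^ 2 ≤ 2 * ∫ t in Ioo s τ, w t (v t) := by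
  have hJ : IntegrableOn (fun t => pivotMap ι (v t)) (Ioo 0 T) :=
    (pivotMap ι).integrable_comp (hv.integrable (by norm_num))
  have hw1 : IntegrableOn w (Ioo 0 T) := hw.integrable (by norm_num)
  obtain ⟨c, hc⟩ := exists_ae_eq_const_add_primitive hT hJ hw1 h
  set w' : ℝ → (H →L[ℝ] ℝ) := (Ioo 0 T).indicator w with hw'
  have hw'2 : MemLp w' 2 := memLp_indicator_of_restrict measurableSet_Ioo hw
  have hw'1 : Integrable w' := integrable_indicator_of_integrableOn measurableSet_Ioo hw1
  set g : ℝ → ℝ := (Ioo 0 T).indicator fun t => ‖ι (v t)‖ ^ 2 with hg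
  have hg1 : Integrable g := 
    integrable_indicator_of_integrableOn measurableSet_Ioo (ι.comp_memLp' hv).norm.integrable_sq
  set Γ : ℝ → ℝ := fun x => ∫ t in (0 : ℝ)..x, g t with hΓ
  set A : Set ℝ := {t | t ∈ Ioo 0 T → pivotMap ι (v t) = c + ∫ s in (0 : ℝ)..t, w s} with hA
  have hA' : ∀ᵐ t, t ∈ A := (ae_restrict_iff' measurableSet_Ioo).1 hc
  -- The good times are those where the primitive of g = ‖ι v‖² has derivative g; by Lebesgue
  -- differentiation almost every time qualifies.
  refine ⟨{t | t ∈ Ioo 0 T ∧ HasDerivAt Γ (g t) t}, ?_, ?_⟩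
  · rw [ae_restrict_iff' measurableSet_Ioo]
    filter_upwards [LocallyIntegrable.ae_hasDerivAt_integral hg1.locallyIntegrable] with t ht h using ⟨h, ht 0⟩
  rintro s ⟨hs, hs'⟩ τ ⟨hτ, hτ'⟩ hsτ
  set V : ℝ → H := (Ioo s τ).indicator v with hV
  have hVsub : Ioo s τ ⊆ Ioo 0 T := Ioo_subset_Ioo hs.1.le hτ.2.le
  have hv' : MemLp v 2 (volume.restrict (Ioo s τ)) := hv.mono_measure (Measure.restrict_mono hVsub le_rfl)
  have hV2 : MemLp V 2 := memLp_indicator_of_restrict measurableSet_Ioo hv'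
  have hV1 : Integrable V :=
    integrable_indicator_of_integrableOn measurableSet_Ioo (hv'.integrable (by norm_num))
  have hG := continuous_integral_translate_apply hw'2 hV2
  set G : ℝ → ℝ := fun r => ∫ t, w' (t - r) (V t) with hGdef
  have hgi : ∀ a b, IntervalIntegrable g volume a b := fun a b => hg1.intervalIntegrable
  have hw'i : ∀ a b, IntervalIntegrable w' volume a b := fun a b => hw'1.intervalIntegrable
  have hprim : ∀ t ∈ Ioo 0 T, ∫ r in (0 : ℝ)..t, w r = ∫ r in (0 : ℝ)..t, w' r := by
    intro t ht
    rw [intervalIntegral.integral_of_le ht.1.le, intervalIntegral.integral_of_le ht.1.le]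
    refine setIntegral_congr_fun measurableSet_Ioc fun r hr => ?_
    rw [hw', indicator_of_mem (show r ∈ Ioo 0 T from ⟨hr.1, hr.2.trans_lt ht.2⟩)]
  -- The energy inequality before division by h. The condition h < s keeps t - h inside (0,T).
  have hincr : ∀ h, 0 < h → h < s →
      Γ τ - Γ (τ - h) - (Γ s - Γ (s - h)) ≤ 2 * ∫ r in (0 : ℝ)..h, G r := by
    intro h h0 hhs
    have hpt : ∀ᵐ t ∂volume.restrict (Ioo s τ),
        g t - g (t - h) ≤ 2 * ∫ r in (0 : ℝ)..h, w' (t - r) (V t) := by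
      rw [ae_restrict_iff' measurableSet_Ioo]
      filter_upwards [hA', (measurePreserving_sub_right volume h).quasiMeasurePreserving.ae hA'] with t h1 h2 ht
      have ht0 : t ∈ Ioo 0 T := hVsub ht
      have ht1 : t - h ∈ Ioo 0 T := ⟨by linarith [ht.1], by linarith [ht0.2]⟩
      rw [hg, indicator_of_mem ht0, indicator_of_mem ht1, hV, indicator_of_mem ht]
      have e1 := h1 ht0
      have e2 := h2 ht1
      rw [hprim _ ht0] at e1
      rw [hprim _ ht1] at e2
      -- The constant c cancels between times t and t - h, leaving the integral of w over (t - h,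
      -- t), evaluated at v(t).
      have e3 : ⟪ι (v t), ι (v t)⟫_ℝ - ⟪ι (v (t - h)), ι (v t)⟫_ℝ =
          ∫ r in (0 : ℝ)..h, w' (t - r) (v t) := by
        rw [← pivotMap_apply, ← pivotMap_apply, e1, e2, ← _root_.sub_apply,
          add_sub_add_left_eq_sub, intervalIntegral.integral_interval_sub_left (hw'i _ _) (hw'i _ _),
          ContinuousLinearMap.intervalIntegral_apply (hw'i _ _),
          intervalIntegral.integral_comp_sub_left (fun r => w' r (v t)) t, sub_zero]
      rw [← e3]
      have e4 := real_inner_self_eq_norm_sq (ι (v t))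
      have e5 := norm_sub_sq_real (ι (v (t - h))) (ι (v t))
      nlinarith [sq_nonneg ‖ι (v (t - h)) - ι (v t)‖]
    obtain ⟨f1, f2⟩ := integral_integral_translate_apply hw'1 hV1 h h0.le
    have i1 : IntegrableOn (fun t => g t - g (t - h)) (Ioo s τ) :=
      (hg1.sub (hg1.comp_sub_right h)).integrableOn
    have m := integral_mono_ae i1 (f1.integrableOn.const_mul 2) hpt
    rw [integral_const_mul] at m
    have m2 : ∫ t in Ioo s τ, ∫ r in (0 : ℝ)..h, w' (t - r) (V t) =
        ∫ r in (0 : ℝ)..h, G r := by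
      rw [hGdef, ← f2]
      refine setIntegral_eq_integral_of_forall_compl_eq_zero fun t ht => ?_
      rw [hV, indicator_of_notMem ht]
      simp
    rw [m2] at m
    refine le_trans (le_of_eq ?_) m
    rw [← integral_Ioc_eq_integral_Ioo, ← intervalIntegral.integral_of_le hsτ.le,
      intervalIntegral.integral_sub (hgi _ _) (hg1.comp_sub_right h).intervalIntegrable,
      intervalIntegral.integral_comp_sub_right (fun t => g t) h]
    have a1 := intervalIntegral.integral_interval_sub_left (hgi 0 τ) (hgi 0 s)
    have a2 := intervalIntegral.integral_interval_sub_left (hgi 0 (τ - h)) (hgi 0 (s - h))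
    rw [← a1, ← a2]
    simp only [hΓ]
    ring
  have hΓτ : HasDerivAt (fun h => Γ (τ - h)) (-g τ) 0 := by
    have := HasDerivAt.comp_const_sub (f := Γ) τ 0 (by simpa using hτ')
    simpa using this
  have hΓs : HasDerivAt (fun h => Γ (s - h)) (-g s) 0 := by
    have := HasDerivAt.comp_const_sub (f := Γ) s 0 (by simpa using hs')
    simpa using this
  have hGd : HasDerivAt (fun h => ∫ r in (0 : ℝ)..h, G r) (G 0) 0 :=
    intervalIntegral.integral_hasDerivAt_right (hG.intervalIntegrable _ _)
      hG.aestronglyMeasurable.stronglyMeasurableAtFilter hG.continuousAt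
  -- This function of h vanishes at 0 and is nonpositive on (0, s), so its derivative g τ - g s - 2
  -- G 0 is nonpositive.
  have hD := ((hΓτ.const_sub (Γ τ)).sub (hΓs.const_sub (Γ s))).sub (hGd.const_mul 2)
  have hlim := hD.tendsto_slope_zero_right
  have hle := le_of_tendsto hlim (b := 0) ?_
  · have hG0 : G 0 = ∫ t in Ioo s τ, w t (v t) := by
      rw [← integral_indicator measurableSet_Ioo]
      simp only [hGdef, sub_zero]
      refine integral_congr_ae (ae_of_all _ fun t => ?_)
      by_cases ht : t ∈ Ioo s τ
      · simp only [hV, hw']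
        rw [indicator_of_mem ht, indicator_of_mem (hVsub ht), indicator_of_mem ht]
      · simp only [hV]
        rw [indicator_of_notMem ht, indicator_of_notMem ht, map_zero]
    rw [← hG0]
    have gτ : g τ = ‖ι (v τ)‖ ^ 2 := indicator_of_mem hτ _
    have gs : g s = ‖ι (v s)‖ ^ 2 := indicator_of_mem hs _
    rw [← gτ, ← gs]
    linarith
  · filter_upwards [Ioo_mem_nhdsGT hs.1] with h hh
    have := hincr h hh.1 hh.2
    rw [smul_eq_mul]
    refine mul_nonpos_of_nonneg_of_nonpos (inv_nonneg.2 hh.1.le) ?_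
    simp only [Pi.sub_apply, zero_add, sub_zero, sub_self, intervalIntegral.integral_same, mul_zero]
    linarith

end Energy

/-! ### Grönwall's inequality and the parabolic estimate. -/

/-- Grönwall's inequality for integrable functions, with exceptional null sets. -/
theorem ae_le_mul_exp_of_le_integral {T a B δ : ℝ} (hT : 0 < T) (ha : 1 ≤ a) (hB : 0 ≤ B)
    {g : ℝ → ℝ} (hg : IntegrableOn g (Ioo 0 T))
    (h : ∀ᵐ t ∂volume.restrict (Ioo 0 T), g t ≤ δ + ∫ r in (0 : ℝ)..t, (a * g r + B)) :
    (∀ t ∈ Icc 0 T, δ + ∫ r in (0 : ℝ)..t, (a * g r + B) ≤ (δ + B) * Real.exp (a * t)) := by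
  have hi : IntegrableOn (fun r => a * g r + B) (Ioo 0 T) := (hg.const_mul a).add (by simp)
  have hii : ∀ t ∈ Icc 0 T, IntervalIntegrable (fun r => a * g r + B) volume 0 t := fun t ht => by
    rw [intervalIntegrable_iff_integrableOn_Ioo_of_le ht.1]
    exact hi.mono_set (Ioo_subset_Ioo_right ht.2)
  set R : ℝ → ℝ := fun t => δ + ∫ r in (0 : ℝ)..t, (a * g r + B) with hR
  have hRc : ContinuousOn R (Icc 0 T) := by
    have := intervalIntegral.continuousOn_primitive_interval (f := fun r => a * g r + B)
      (μ := volume) (a := 0) (b := T)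
      (by rw [uIcc_of_le hT.le, integrableOn_Icc_iff_integrableOn_Ioo]; exact hi)
    rw [uIcc_of_le hT.le] at this
    exact continuousOn_const.add this
  set R' : ℝ → ℝ := IccExtend hT.le ((Icc 0 T).domRestrict R) with hR'
  have hR'c : Continuous R' := (continuousOn_iff_continuous_domRestrict.1 hRc).Icc_extend'
  have hRR' : ∀ t ∈ Icc 0 T, R' t = R t := fun t ht => by
    rw [hR', IccExtend_of_mem _ _ ht, Set.domRestrict_apply]
  have hic : ∀ x y, IntervalIntegrable (fun r => a * R' r + B) volume x y := fun x y =>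
    ((hR'c.const_mul a).add continuous_const).intervalIntegrable x y
  -- g is only integrable, so R need not be differentiable everywhere. Replacing g by the continuous
  -- R gives a C¹ majorant Z with Z' ≤ aZ + B on [0,T), to which the classical Grönwall bound
  -- applies.
  set Z : ℝ → ℝ := fun t => δ + ∫ r in (0 : ℝ)..t, (a * R' r + B) with hZ
  have hRZ : ∀ t ∈ Icc 0 T, R t ≤ Z t := by
    intro t ht
    refine add_le_add le_rfl ?_
    refine intervalIntegral.integral_mono_ae_restrict ht.1 (hii t ht) (hic _ _) ?_
    rw [← restrict_Ioo_eq_restrict_Icc]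
    refine ae_restrict_of_ae_restrict_of_subset (Ioo_subset_Ioo_right ht.2) ?_
    filter_upwards [h, ae_restrict_mem measurableSet_Ioo] with r hr hr2
    rw [hRR' r (Ioo_subset_Icc_self hr2)]
    have : g r ≤ R r := hr
    nlinarith
  have hZd : ∀ t, HasDerivAt Z (a * R' t + B) t := fun t => by
    refine HasDerivAt.const_add _ ?_
    exact intervalIntegral.integral_hasDerivAt_right (hic _ _)
      (by fun_prop : Continuous fun r => a * R' r + B).aestronglyMeasurable.stronglyMeasurableAtFilter
      (by fun_prop : Continuous fun r => a * R' r + B).continuousAt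
  have hgw := le_gronwallBound_of_liminf_deriv_right_le (f := Z) (f' := fun t => a * R' t + B)
    (δ := δ) (K := a) (ε := B) (a := 0) (b := T)
    (fun t _ => (hZd t).continuousAt.continuousWithinAt)
    (fun x _ r hr => ((hZd x).hasDerivWithinAt.liminf_right_slope_le hr))
    (by simp [hZ])
    (fun x hx => by
      have := hRZ x (Ico_subset_Icc_self hx)
      rw [← hRR' x (Ico_subset_Icc_self hx)] at this
      nlinarith)
  intro t ht
  refine (hRZ t ht).trans ((hgw t ht).trans ?_)
  rw [gronwallBound_of_K_ne_0 (by linarith), sub_zero]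
  have h1 : 1 ≤ Real.exp (a * t) := Real.one_le_exp (by nlinarith [ht.1])
  -- Since a ≥ 1, the source B contributes no factor T outside the exponential.
  have h2 : B / a ≤ B := div_le_self hB ha
  have h3 : B / a * (Real.exp (a * t) - 1) ≤ B * (Real.exp (a * t) - 1) :=
    mul_le_mul_of_nonneg_right h2 (by linarith)
  nlinarith

/-- A neighbourhood of x, even of an endpoint, meets (0,T) in a nonempty open set, which has
positive measure. This allows inequalities to pass to essential limits at 0 and at T. -/
theorem ae_inf_nhds_neBot {T x : ℝ} (hT : 0 < T) (hx : x ∈ Icc 0 T) :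
    (ae (volume.restrict (Ioo 0 T)) ⊓ 𝓝 x).NeBot := by
  rw [inf_neBot_iff]
  intro s hs s' hs'
  by_contra hcon
  obtain ⟨U, hU, hUo, hxU⟩ := mem_nhds_iff.1 hs'
  have h1 : ∀ᵐ y ∂volume.restrict (Ioo 0 T), y ∈ s := hs
  rw [ae_restrict_iff' measurableSet_Ioo] at h1
  have h2 : ∀ᵐ y : ℝ, y ∉ U ∩ Ioo 0 T := by
    filter_upwards [h1] with y hy hy' using hcon ⟨y, hy hy'.2, hU hy'.1⟩
  rw [← closure_Ioo hT.ne] at hx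
  refine ((hUo.inter isOpen_Ioo).measure_pos volume (mem_closure_iff.1 hx U hUo hxU)).ne' ?_
  exact measure_eq_zero_iff_ae_notMem.2 h2

section Parabolic

variable {H E : Type*} [NormedAddCommGroup H] [NormedSpace ℝ H]
  [NormedAddCommGroup E] [InnerProductSpace ℝ E]

/-- The parabolic energy estimate: a differential inequality for the dual pairing of the weak time
derivative yields bounds independent of the final time up to an exponential factor. -/
theorem parabolic_energy_estimate (ι : H →L[ℝ] E) {T : ℝ} (hT : 0 < T) {v : ℝ → H}
    {w : ℝ → (H →L[ℝ] ℝ)} (hv : MemLp v 2 (volume.restrict (Ioo 0 T)))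
    (hw : MemLp w 2 (volume.restrict (Ioo 0 T)))
    (h : ∀ φ : H, ∀ η : ℝ → ℝ, ContDiff ℝ ∞ η → HasCompactSupport η → tsupport η ⊆ Ioo 0 T →
      ∫ t in Ioo 0 T, deriv η t * ⟪ι (v t), ι φ⟫_ℝ = - ∫ t in Ioo 0 T, η t * w t φ)
    {e₀ : E} (h0 : Tendsto (fun t => ι (v t)) (ae (volume.restrict (Ioo 0 T)) ⊓ 𝓝 0) (𝓝 e₀))
    {P : ℝ → ℝ} (hP : IntegrableOn P (Ioo 0 T)) (hP0 : ∀ t, 0 ≤ P t) {a B : ℝ} (ha : 1 ≤ a)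
    (hB : 0 ≤ B)
    (hineq : ∀ᵐ t ∂volume.restrict (Ioo 0 T), 2 * w t (v t) + P t ≤ a * ‖ι (v t)‖ ^ 2 + B) :
    (∀ᵐ t ∂volume.restrict (Ioo 0 T), ‖ι (v t)‖ ^ 2 ≤ (‖e₀‖ ^ 2 + B) * Real.exp (a * T)) ∧
    ∫ t in Ioo 0 T, ‖ι (v t)‖ ^ 2 ≤ (‖e₀‖ ^ 2 + B) * Real.exp (a * T) ∧
    ∫ t in Ioo 0 T, P t ≤ (‖e₀‖ ^ 2 + B) * Real.exp (a * T) := by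
  obtain ⟨S, hS, hSineq⟩ := exists_energy_inequality ι hT hv hw h
  have hg : IntegrableOn (fun t => ‖ι (v t)‖ ^ 2) (Ioo 0 T) :=
    (ι.comp_memLp' hv).norm.integrable_sq
  set g : ℝ → ℝ := fun t => ‖ι (v t)‖ ^ 2 with hgdef
  have hwv : IntegrableOn (fun t => w t (v t)) (Ioo 0 T) :=
    (hw.norm.integrable_mul hv.norm).mono'
      (isBoundedBilinearMap_apply.continuous.comp_aestronglyMeasurable (hw.1.prodMk hv.1))
      (ae_of_all _ fun t => (w t).le_opNorm (v t))
  have hneBot := ae_inf_nhds_neBot hT ⟨le_rfl, hT.le⟩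
  have hsub : ∀ {s t : ℝ}, s ∈ Ioo 0 T → t ∈ Icc 0 T → Ioo s t ⊆ Ioo 0 T := fun hs ht =>
    Ioo_subset_Ioo hs.1.le ht.2
  have hi : IntegrableOn (fun r => a * g r + B) (Ioo 0 T) := (hg.const_mul a).add (by simp)
  have hii : ∀ {t}, t ∈ Icc 0 T → IntervalIntegrable (fun r => a * g r + B) volume 0 t :=
    fun ht => by
    rw [intervalIntegrable_iff_integrableOn_Ioo_of_le ht.1]
    exact hi.mono_set (Ioo_subset_Ioo_right ht.2)
  have hPi : ∀ {t}, t ∈ Icc 0 T → IntervalIntegrable P volume 0 t := fun ht => by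
    rw [intervalIntegrable_iff_integrableOn_Ioo_of_le ht.1]
    exact hP.mono_set (Ioo_subset_Ioo_right ht.2)
  -- The energy inequality holds between good times s < τ; letting s → 0 through good times brings
  -- in the initial value.
  have hfrom0 : ∀ τ ∈ S, τ ∈ Ioo 0 T →
      g τ + ∫ r in (0 : ℝ)..τ, P r ≤ ‖e₀‖ ^ 2 + ∫ r in (0 : ℝ)..τ, (a * g r + B) := by
    intro τ hτ hτT
    have hev : ∀ᶠ s in ae (volume.restrict (Ioo 0 T)) ⊓ 𝓝 (0 : ℝ),
        g τ + ((∫ r in (0 : ℝ)..τ, P r) - ∫ r in (0 : ℝ)..s, P r) ≤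
          g s + ((∫ r in (0 : ℝ)..τ, (a * g r + B)) - ∫ r in (0 : ℝ)..s, (a * g r + B)) := by
      have e1 : ∀ᶠ s in ae (volume.restrict (Ioo 0 T)) ⊓ 𝓝 (0 : ℝ), s ∈ S ∧ s ∈ Ioo 0 T :=
        (hS.and (ae_restrict_mem measurableSet_Ioo)).filter_mono inf_le_left
      have e2 : ∀ᶠ s in ae (volume.restrict (Ioo 0 T)) ⊓ 𝓝 (0 : ℝ), s < τ :=
        (eventually_lt_nhds hτT.1).filter_mono inf_le_right
      filter_upwards [e1, e2] with s hs hsτ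
      have k1 := hSineq s hs.1 τ hτ hsτ
      have hsI := Ioo_subset_Icc_self hs.2
      have hτI := Ioo_subset_Icc_self hτT
      rw [intervalIntegral.integral_interval_sub_left (hPi hτI) (hPi hsI),
        intervalIntegral.integral_interval_sub_left (hii hτI) (hii hsI),
        intervalIntegral.integral_of_le hsτ.le, intervalIntegral.integral_of_le hsτ.le,
        integral_Ioc_eq_integral_Ioo, integral_Ioc_eq_integral_Ioo]
      have hm := integral_mono_ae
        (((hwv.mono_set (hsub hs.2 hτI)).const_mul 2).add (hP.mono_set (hsub hs.2 hτI)))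
        (hi.mono_set (hsub hs.2 hτI))
        (ae_restrict_of_ae_restrict_of_subset (hsub hs.2 hτI) hineq)
      simp only [Pi.add_apply] at hm
      rw [integral_add ((hwv.mono_set (hsub hs.2 hτI)).const_mul 2) (hP.mono_set (hsub hs.2 hτI)),
        integral_const_mul] at hm
      simp only [hgdef] at *
      linarith
    have hlimprim : ∀ {q : ℝ → ℝ}, IntegrableOn q (Ioo 0 T) →
        Tendsto (fun s => ∫ r in (0 : ℝ)..s, q r) (ae (volume.restrict (Ioo 0 T)) ⊓ 𝓝 (0 : ℝ))
          (𝓝 0) := by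
      intro q hq
      have hc := intervalIntegral.continuousOn_primitive_interval (f := q)
        (μ := volume) (a := 0) (b := T)
        (by rw [uIcc_of_le hT.le, integrableOn_Icc_iff_integrableOn_Ioo]; exact hq)
      rw [uIcc_of_le hT.le] at hc
      have h0' := hc 0 ⟨le_rfl, hT.le⟩
      rw [ContinuousWithinAt, intervalIntegral.integral_same] at h0'
      refine h0'.mono_left ?_
      rw [nhdsWithin, inf_comm]
      refine inf_le_inf_left _ ?_
      rw [le_principal_iff]
      filter_upwards [ae_restrict_mem measurableSet_Ioo] with x hx using Ioo_subset_Icc_self hx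
    have l1 := ((tendsto_const_nhds (x := ∫ r in (0 : ℝ)..τ, P r)).sub (hlimprim hP)).const_add (g τ)
    have l2 := ((h0.norm.pow 2)).add
      ((tendsto_const_nhds (x := ∫ r in (0 : ℝ)..τ, (a * g r + B))).sub (hlimprim hi))
    have := le_of_tendsto_of_tendsto l1 l2 hev
    simpa using this
  have hae : ∀ᵐ t ∂volume.restrict (Ioo 0 T),
      g t ≤ ‖e₀‖ ^ 2 + ∫ r in (0 : ℝ)..t, (a * g r + B) := by
    filter_upwards [hS, ae_restrict_mem measurableSet_Ioo] with t ht ht2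
    have := hfrom0 t ht ht2
    have hp : 0 ≤ ∫ r in (0 : ℝ)..t, P r :=
      intervalIntegral.integral_nonneg ht2.1.le fun r _ => hP0 r
    linarith
  have hR := ae_le_mul_exp_of_le_integral hT ha hB hg hae
  have hexp : ∀ t ∈ Icc 0 T, (‖e₀‖ ^ 2 + B) * Real.exp (a * t) ≤
      (‖e₀‖ ^ 2 + B) * Real.exp (a * T) := fun t ht => by
    gcongr
    exact ht.2
  have hTmem : T ∈ Icc 0 T := ⟨hT.le, le_rfl⟩
  refine ⟨?_, ?_, ?_⟩
  · filter_upwards [hae, ae_restrict_mem measurableSet_Ioo] with t ht ht2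
    have hm := Ioo_subset_Icc_self ht2
    exact ht.trans ((hR t hm).trans (hexp t hm))
  -- Integrating the pointwise bound would cost a factor T. The Grönwall bound at time T already
  -- contains a∫g, and a ≥ 1.
  · have h1 := hR T hTmem
    rw [intervalIntegral.integral_of_le hT.le, integral_Ioc_eq_integral_Ioo,
      integral_add (hg.const_mul a) (by simp), integral_const_mul] at h1
    have h2 : 0 ≤ ∫ t in Ioo 0 T, g t := integral_nonneg fun t => sq_nonneg _
    have h3 : 0 ≤ ∫ t in Ioo 0 T, B := integral_nonneg fun t => hB
    nlinarith [sq_nonneg ‖e₀‖]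
  -- T is not a good time itself, so the bound is reached as a limit of good times τ → T.
  · have hev : ∀ᶠ τ in ae (volume.restrict (Ioo 0 T)) ⊓ 𝓝 T,
        (∫ r in (0 : ℝ)..τ, P r) ≤ (‖e₀‖ ^ 2 + B) * Real.exp (a * T) := by
      have e1 : ∀ᶠ s in ae (volume.restrict (Ioo 0 T)) ⊓ 𝓝 T, s ∈ S ∧ s ∈ Ioo 0 T :=
        (hS.and (ae_restrict_mem measurableSet_Ioo)).filter_mono inf_le_left
      filter_upwards [e1] with τ hτ
      have hm := Ioo_subset_Icc_self hτ.2
      have k := hfrom0 τ hτ.1 hτ.2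
      have := (hR τ hm).trans (hexp τ hm)
      have : 0 ≤ g τ := sq_nonneg _
      linarith
    have hneBotT := ae_inf_nhds_neBot hT hTmem
    have hc := intervalIntegral.continuousOn_primitive_interval (f := P)
      (μ := volume) (a := 0) (b := T)
      (by rw [uIcc_of_le hT.le, integrableOn_Icc_iff_integrableOn_Ioo]; exact hP)
    rw [uIcc_of_le hT.le] at hc
    have hle : ae (volume.restrict (Ioo 0 T)) ⊓ 𝓝 T ≤ 𝓝[Icc 0 T] T := by
      rw [nhdsWithin, inf_comm]
      refine inf_le_inf_left _ ?_
      rw [le_principal_iff]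
      filter_upwards [ae_restrict_mem measurableSet_Ioo] with x hx using Ioo_subset_Icc_self hx
    have := le_of_tendsto ((hc T hTmem).mono_left hle) hev
    dsimp only at this
    rwa [intervalIntegral.integral_of_le hT.le, integral_Ioc_eq_integral_Ioo] at this

end Parabolic

/-! ### Sobolev functions, Lebesgue norms and time slices. -/

namespace ConvDiff

section Sobolev

variable {N : ℕ} {D : Set (Space N)}

/-- The function underlying a Sobolev function, as a continuous linear map. -/
noncomputable def fnL (D : Set (Space N)) (p : ℝ≥0∞) [Fact (1 ≤ p)] :
    W1 D p →L[ℝ] Lp ℝ p (vol D) :=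
  (WithLp.fstL 1 ℝ _ _) ∘L (W1 D p).subtypeL

/-- The weak gradient of a Sobolev function, as a continuous linear map. -/
noncomputable def gradL (D : Set (Space N)) (p : ℝ≥0∞) [Fact (1 ≤ p)] :
    W1 D p →L[ℝ] Lp (Space N) p (vol D) :=
  (WithLp.sndL 1 ℝ _ _) ∘L (W1 D p).subtypeL

theorem fnL_apply {p : ℝ≥0∞} [Fact (1 ≤ p)] (v : W1 D p) : fnL D p v = fn v := rfl

theorem fn_sub {p : ℝ≥0∞} [Fact (1 ≤ p)] (v w : W1 D p) : fn (v - w) = fn v - fn w := rfl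

theorem grad_sub {p : ℝ≥0∞} [Fact (1 ≤ p)] (v w : W1 D p) : grad (v - w) = grad v - grad w := rfl

theorem norm_W1_eq {p : ℝ≥0∞} [Fact (1 ≤ p)] (v : W1 D p) : ‖v‖ = ‖fn v‖ + ‖grad v‖ :=
  WithLp.prod_norm_eq_of_L1 v.1

theorem norm_grad_le {p : ℝ≥0∞} [Fact (1 ≤ p)] (v : W1 D p) : ‖grad v‖ ≤ ‖v‖ := by
  rw [norm_W1_eq]
  linarith [norm_nonneg (fn v)]

theorem separableSpace_H1 : TopologicalSpace.SeparableSpace (H1 D) := by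
  have : Fact ((2 : ℝ≥0∞) ≠ ⊤) := ⟨ENNReal.ofNat_ne_top⟩
  have h1 : SecondCountableTopology (Lp ℝ 2 (vol D)) := inferInstance
  have h2 : SecondCountableTopology (Lp (Space N) 2 (vol D)) := inferInstance
  have h3 : SecondCountableTopology (WithLp 1 (Lp ℝ 2 (vol D) × Lp (Space N) 2 (vol D))) :=
    WithLp.secondCountableTopology 1 _ _
  have h4 : SecondCountableTopology (H1 D) := TopologicalSpace.Subtype.secondCountableTopology _
  exact TopologicalSpace.SecondCountableTopology.to_separableSpace

end Sobolev

section Lp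

variable {X F : Type*} [MeasurableSpace X] {μ : Measure X} [NormedAddCommGroup F]

theorem ae_norm_le_norm_of_Lp_top (a : Lp F ∞ μ) : ∀ᵐ x ∂μ, ‖a x‖ ≤ ‖a‖ := by
  have h := ae_le_eLpNormEssSup (f := a) (μ := μ)
  filter_upwards [h] with x hx
  rw [Lp.norm_def, eLpNorm_exponent_top]
  have hfin : eLpNormEssSup a μ ≠ ⊤ := by
    have := Lp.eLpNorm_ne_top a
    rwa [eLpNorm_exponent_top] at this
  have := ENNReal.toReal_mono hfin hx
  simpa using this

theorem norm_sq_Lp_two_eq_integral (a : Lp F 2 μ) : ‖a‖ ^ 2 = ∫ x, ‖a x‖ ^ 2 ∂μ := by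
  have h := (Lp.memLp a).eLpNorm_eq_integral_rpow_norm (by simp) (by simp)
  have hnn : 0 ≤ ∫ x, ‖a x‖ ^ 2 ∂μ := integral_nonneg fun x => sq_nonneg _
  rw [Lp.norm_def, h, ENNReal.toReal_ofReal (by positivity)]
  simp only [ENNReal.toReal_ofNat, Real.rpow_ofNat]
  rw [← Real.rpow_natCast, ← Real.rpow_mul hnn]
  norm_num

theorem integrable_norm_sq_Lp_two (a : Lp F 2 μ) : Integrable (fun x => ‖a x‖ ^ 2) μ :=
  (Lp.memLp a).norm.integrable_sq

theorem ae_norm_sub_le_of_ae_norm_le {p : ℝ≥0∞} (a b : Lp F p μ) {c : ℝ}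
    (h : ∀ᵐ x ∂μ, ‖(a - b) x‖ ≤ c) : ∀ᵐ x ∂μ, ‖a x - b x‖ ≤ c := by
  filter_upwards [h, Lp.coeFn_sub a b] with x h1 h2
  rw [h2] at h1
  exact h1

/-- The weak formulation has a null set depending on the test function. A countable dense set and
continuity merge these into one, so that the time-dependent test function u(t) becomes admissible.
-/
theorem ae_forall_eq_zero {Y : Type*} [TopologicalSpace Y] [TopologicalSpace.SeparableSpace Y] {Φ : X → Y → ℝ}
    (hc : ∀ᵐ t ∂μ, Continuous (Φ t)) (h : ∀ y, ∀ᵐ t ∂μ, Φ t y = 0) :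
    ∀ᵐ t ∂μ, ∀ y, Φ t y = 0 := by
  obtain ⟨s, hs, hd⟩ := TopologicalSpace.exists_countable_dense Y
  have h' : ∀ᵐ t ∂μ, ∀ y ∈ s, Φ t y = 0 := (ae_ball_iff hs).2 fun y _ => h y
  filter_upwards [hc, h'] with t ht1 ht2 y
  exact congrFun (Continuous.ext_on hd ht1 continuous_const ht2) y

end Lp

section Slices

variable {N : ℕ} {D : Set (Space N)} {T : ℝ}

theorem cylVol_eq_prod : cylVol T D = (timeVol T).prod (vol D) := by
  rw [Measure.prod_restrict]
  rfl

theorem ae_ae_of_ae_cylVol {P : ℝ × Space N → Prop} (h : ∀ᵐ z ∂(cylVol T D), P z) :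
    ∀ᵐ t ∂(timeVol T), ∀ᵐ x ∂(vol D), P (t, x) := by
  rw [cylVol_eq_prod] at h
  exact Measure.ae_ae_of_ae_prod h

theorem ae_aestronglyMeasurable_slice (a : Lp ℝ ∞ (cylVol T D)) :
    ∀ᵐ t ∂(timeVol T), AEStronglyMeasurable (fun x => a (t, x)) (vol D) := by
  have h := (Lp.memLp a).1.mono_ac cylVol_eq_prod.symm.absolutelyContinuous
  exact h.prodMk_left

theorem ae_ae_abs_slice_le (a : Lp ℝ ∞ (cylVol T D)) :
    ∀ᵐ t ∂(timeVol T), ∀ᵐ x ∂(vol D), |a (t, x)| ≤ ‖a‖ :=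
  ae_ae_of_ae_cylVol (ae_norm_le_norm_of_Lp_top a)

theorem ae_ae_abs_slice_sub_le (a b : Lp ℝ ∞ (cylVol T D)) :
    ∀ᵐ t ∂(timeVol T), ∀ᵐ x ∂(vol D), |a (t, x) - b (t, x)| ≤ ‖a - b‖ := by
  refine ae_ae_of_ae_cylVol (P := fun z => |a z - b z| ≤ ‖a - b‖) ?_
  filter_upwards [ae_norm_le_norm_of_Lp_top (a - b), Lp.coeFn_sub a b] with z h1 h2
  rw [h2] at h1
  exact h1

theorem ae_ae_norm_grad_le (V : Lp (W1 D ∞) ∞ (timeVol T)) :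
    ∀ᵐ t ∂(timeVol T), ∀ᵐ x ∂(vol D), ‖grad (V t) x‖ ≤ ‖V‖ := by
  filter_upwards [ae_norm_le_norm_of_Lp_top V] with t ht
  filter_upwards [ae_norm_le_norm_of_Lp_top (grad (V t))] with x hx
  exact hx.trans ((norm_grad_le _).trans ht)

theorem ae_ae_norm_grad_sub_le (V W : Lp (W1 D ∞) ∞ (timeVol T)) :
    ∀ᵐ t ∂(timeVol T), ∀ᵐ x ∂(vol D), ‖grad (V t) x - grad (W t) x‖ ≤ ‖V - W‖ := by
  have hs : ∀ᵐ t ∂(timeVol T), (V - W) t = V t - W t := Lp.coeFn_sub V W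
  refine ((ae_ae_norm_grad_le (V - W)).and hs).mono fun t ht => ?_
  have h1 : grad ((V - W) t) = grad (V t) - grad (W t) := by
    rw [ht.2]
    exact grad_sub _ _
  refine ae_norm_sub_le_of_ae_norm_le (grad (V t)) (grad (W t)) ?_
  rw [← h1]
  exact ht.1

theorem IsUniformlyPositive.ae_ae_nonneg {a : Lp ℝ ∞ (cylVol T D)} (ha : IsUniformlyPositive a) :
    ∀ᵐ t ∂(timeVol T), ∀ᵐ x ∂(vol D), 0 ≤ a (t, x) := by
  obtain ⟨a₀, h0, h⟩ := ha
  exact ae_ae_of_ae_cylVol (P := fun z => 0 ≤ a z) (h.mono fun z hz => h0.le.trans hz)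

end Slices

/-! ### The weak formulation at a fixed time. -/

section FixedTime

variable {N : ℕ} {D : Set (Space N)}

/-- The right-hand side of the weak formulation at a fixed time, tested against `φ`. -/
noncomputable def weakIntegrand (f : ℝ → ℝ) (a b : Space N → ℝ) (V : W1 D ∞) (u φ : H1 D)
    (x : Space N) : ℝ :=
  ⟪-grad u x + f (fn u x) • grad V x, grad φ x⟫_ℝ - b x * fn u x * fn φ x
    + a x * f (fn u x) * fn φ x

theorem memLp_flux [IsFiniteMeasure (vol D)] {f : ℝ → ℝ} {L : ℝ≥0} {K : ℝ}
    (hf : IsAdmissibleMobility L K f) (u : H1 D) (V : W1 D ∞) :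
    MemLp (fun x => -grad u x + f (fn u x) • grad V x) 2 (vol D) := by
  have hm : AEStronglyMeasurable (fun x => f (fn u x)) (vol D) :=
    hf.lipschitz.continuous.comp_aestronglyMeasurable (Lp.aestronglyMeasurable _)
  refine (Lp.memLp (grad u)).neg.add ?_
  have hV : MemLp (grad V) 2 (vol D) := (Lp.memLp (grad V)).mono_exponent le_top
  refine MemLp.of_le_mul (c := K) hV (hm.smul hV.1) (ae_of_all _ fun x => ?_)
  rw [norm_smul]
  exact mul_le_mul_of_nonneg_right (hf.bounded _) (norm_nonneg _)

theorem memLp_mul_of_ae_abs_le {a u : Space N → ℝ} {A : ℝ}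
    (hm : AEStronglyMeasurable a (vol D)) (ha : ∀ᵐ x ∂(vol D), |a x| ≤ A)
    (hu : MemLp u 2 (vol D)) : MemLp (fun x => a x * u x) 2 (vol D) :=
  MemLp.of_le_mul hu (hm.mul hu.1) (ha.mono fun x hx => by
    rw [norm_mul]
    exact mul_le_mul_of_nonneg_right hx (norm_nonneg _))

theorem memLp_comp_mobility [IsFiniteMeasure (vol D)] {f : ℝ → ℝ} {L : ℝ≥0} {K : ℝ}
    (hf : IsAdmissibleMobility L K f) (u : H1 D) : MemLp (fun x => f (fn u x)) 2 (vol D) :=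
  MemLp.of_bound (hf.lipschitz.continuous.comp_aestronglyMeasurable (Lp.aestronglyMeasurable _)) K
    (ae_of_all _ fun _ => hf.bounded _)

end FixedTime

end ConvDiff

theorem integrable_inner_of_memLp_two {X F : Type*} [MeasurableSpace X] {μ : Measure X}
    [NormedAddCommGroup F] [InnerProductSpace ℝ F] {h : X → F} (hh : MemLp h 2 μ)
    (G : Lp F 2 μ) : Integrable (fun x => ⟪h x, G x⟫_ℝ) μ ∧
      ∫ x, ⟪h x, G x⟫_ℝ ∂μ = ⟪hh.toLp h, G⟫_ℝ := by
  have e : (fun x => ⟪hh.toLp h x, G x⟫_ℝ) =ᵐ[μ] fun x => ⟪h x, G x⟫_ℝ := by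
    filter_upwards [hh.coeFn_toLp] with x hx
    rw [hx]
  exact ⟨(L2.integrable_inner (𝕜 := ℝ) (hh.toLp h) G).congr e,
    by rw [L2.inner_def, integral_congr_ae e]⟩

theorem integrable_mul_of_memLp_two {X : Type*} [MeasurableSpace X] {μ : Measure X}
    {h : X → ℝ} (hh : MemLp h 2 μ) (G : Lp ℝ 2 μ) : Integrable (fun x => h x * G x) μ ∧
      ∫ x, h x * G x ∂μ = ⟪hh.toLp h, G⟫_ℝ := by
  have e : (fun x => h x * G x) = fun x => ⟪h x, G x⟫_ℝ := by
    funext x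
    simp [mul_comm]
  rw [e]
  exact integrable_inner_of_memLp_two hh G

namespace ConvDiff

/-- Bounded measurable reaction coefficients at a fixed time. -/
structure IsBoundedCoeff {N : ℕ} (D : Set (Space N)) (a : Space N → ℝ) : Prop where
  aestronglyMeasurable : AEStronglyMeasurable a (vol D)
  bounded : ∃ A : ℝ, ∀ᵐ x ∂(vol D), |a x| ≤ A

theorem memLp_reaction {N : ℕ} {D : Set (Space N)} {a : Space N → ℝ} (ha : IsBoundedCoeff D a) {u : Space N → ℝ}
    (hu : MemLp u 2 (vol D)) : MemLp (fun x => a x * u x) 2 (vol D) := by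
  obtain ⟨A, hA⟩ := ha.bounded
  exact memLp_mul_of_ae_abs_le ha.aestronglyMeasurable hA hu

section FixedTime

variable {N : ℕ} {D : Set (Space N)} [IsFiniteMeasure (vol D)] {f : ℝ → ℝ} {L : ℝ≥0} {K : ℝ}

theorem integrable_weakIntegrand (hf : IsAdmissibleMobility L K f) {a b : Space N → ℝ}
    (ha : IsBoundedCoeff D a) (hb : IsBoundedCoeff D b) (V : W1 D ∞) (u φ : H1 D) :
    Integrable (weakIntegrand f a b V u φ) (vol D) :=
  ((integrable_inner_of_memLp_two (memLp_flux hf u V) (grad φ)).1.sub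
    (integrable_mul_of_memLp_two (memLp_reaction hb (Lp.memLp (fn u))) (fn φ)).1).add
    (integrable_mul_of_memLp_two (memLp_reaction ha (memLp_comp_mobility hf u)) (fn φ)).1

theorem integral_weakIntegrand (hf : IsAdmissibleMobility L K f) {a b : Space N → ℝ}
    (ha : IsBoundedCoeff D a) (hb : IsBoundedCoeff D b) (V : W1 D ∞) (u φ : H1 D) :
    ∫ x in D, weakIntegrand f a b V u φ x =
      (∫ x in D, ⟪-grad u x + f (fn u x) • grad V x, grad φ x⟫_ℝ)
        - (∫ x in D, b x * fn u x * fn φ x) + ∫ x in D, a x * f (fn u x) * fn φ x := by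
  have h1 := (integrable_inner_of_memLp_two (memLp_flux hf u V) (grad φ)).1
  have h2 := (integrable_mul_of_memLp_two (memLp_reaction hb (Lp.memLp (fn u))) (fn φ)).1
  have h3 := (integrable_mul_of_memLp_two
    (memLp_reaction ha (memLp_comp_mobility hf u)) (fn φ)).1
  exact (integral_add' (h1.sub h2) h3).trans (by rw [integral_sub' h1 h2])

/-- Each term is the L² inner product of a fixed function with the value or the gradient of φ. -/
theorem continuous_integral_weakIntegrand (hf : IsAdmissibleMobility L K f) {a b : Space N → ℝ}
    (ha : IsBoundedCoeff D a) (hb : IsBoundedCoeff D b) (V : W1 D ∞) (u : H1 D) :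
    Continuous fun φ : H1 D => ∫ x in D, weakIntegrand f a b V u φ x := by
  have h1 := fun φ : H1 D => (integrable_inner_of_memLp_two (memLp_flux hf u V) (grad φ)).2
  have h2 := fun φ : H1 D =>
    (integrable_mul_of_memLp_two (memLp_reaction hb (Lp.memLp (fn u))) (fn φ)).2
  have h3 := fun φ : H1 D => (integrable_mul_of_memLp_two
    (memLp_reaction ha (memLp_comp_mobility hf u)) (fn φ)).2
  have e : (fun φ : H1 D => ∫ x in D, weakIntegrand f a b V u φ x) = fun φ =>
      ⟪(memLp_flux hf u V).toLp _, gradL D 2 φ⟫_ℝ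
        - ⟪(memLp_reaction hb (Lp.memLp (fn u))).toLp _, fnL D 2 φ⟫_ℝ
        + ⟪(memLp_reaction ha (memLp_comp_mobility hf u)).toLp _, fnL D 2 φ⟫_ℝ := by
    funext φ
    rw [integral_weakIntegrand hf ha hb, h1, h2, h3]
    rfl
  rw [e]
  fun_prop

theorem abs_inner_le_mul {F : Type*} [NormedAddCommGroup F] [InnerProductSpace ℝ F] {x y : F}
    {c : ℝ} (h : ‖x‖ ≤ c) : |⟪x, y⟫_ℝ| ≤ c * ‖y‖ :=
  (abs_real_inner_le_norm x y).trans (mul_le_mul_of_nonneg_right h (norm_nonneg _))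

/-- Young's inequality, from (p - εq)² ≥ 0, with r any upper bound for p²/ε. -/
theorem two_mul_mul_le_of_abs_le {x p q r : ℝ} (hx : |x| ≤ p * q) (ε : ℝ) (hε : 0 < ε)
    (hr : p ^ 2 ≤ r * ε) : 2 * x ≤ r + ε * q ^ 2 := by
  have h1 := le_of_abs_le hx
  have h2 : 0 ≤ (p - ε * q) ^ 2 := sq_nonneg _
  have h3 : ε * (2 * x) ≤ ε * (r + ε * q ^ 2) := by nlinarith
  exact le_of_mul_le_mul_left h3 hε

/-- Testing the equation with the solution itself: the pointwise bound. -/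
theorem two_mul_energy_density_le {F : Type*} [NormedAddCommGroup F] [InnerProductSpace ℝ F]
    {G W : F} {a b u φ K ν A : ℝ} (hφ : |φ| ≤ K) (hW : ‖W‖ ≤ ν) (ha : |a| ≤ A) (hb : 0 ≤ b) :
    2 * (⟪-G + φ • W, G⟫_ℝ - b * u * u + a * φ * u) + ‖G‖ ^ 2 ≤
      u ^ 2 + K ^ 2 * (ν ^ 2 + A ^ 2) := by
  have hK : 0 ≤ K := (abs_nonneg _).trans hφ
  rw [inner_add_left, inner_neg_left, real_inner_self_eq_norm_sq]
  have e1 : ‖φ • W‖ ≤ K * ν := by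
    rw [norm_smul]
    exact mul_le_mul hφ hW (norm_nonneg _) hK
  -- Diffusion gives -2‖G‖² and the left side carries +‖G‖², so exactly one ‖G‖² is free for the
  -- drift: ε = 1.
  have h1 := two_mul_mul_le_of_abs_le (abs_inner_le_mul (y := G) e1) 1 one_pos
    (r := (K * ν) ^ 2) (by simp)
  have e2 : |a * φ * u| ≤ (A * K) * |u| := by
    rw [abs_mul, abs_mul]
    have := abs_nonneg a
    gcongr
    linarith
  have h2 := two_mul_mul_le_of_abs_le e2 1 one_pos (r := (A * K) ^ 2) (by simp)
  rw [sq_abs] at h2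
  have h3 : 0 ≤ b * u * u := by nlinarith [mul_nonneg hb (sq_nonneg u)]
  nlinarith

/-- Testing the difference of two equations with the difference of the solutions: the pointwise
bound. -/
theorem two_mul_difference_density_le {F : Type*} [NormedAddCommGroup F] [InnerProductSpace ℝ F]
    {G₁ G₂ W₁ W₂ : F} {a₁ a₂ b₁ b₂ u₁ u₂ φ₁ φ₂ K ν A dV da db L : ℝ} (hφ₁ : |φ₁| ≤ K)
    (hφ₂ : |φ₂| ≤ K) (hL : 0 ≤ L) (hφ : |φ₁ - φ₂| ≤ L * |u₁ - u₂|) (hW : ‖W₁‖ ≤ ν)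
    (hdW : ‖W₁ - W₂‖ ≤ dV) (ha₂ : |a₂| ≤ A) (hda : |a₁ - a₂| ≤ da) (hb₁ : 0 ≤ b₁)
    (hdb : |b₁ - b₂| ≤ db) :
    2 * ((⟪-G₁ + φ₁ • W₁, G₁ - G₂⟫_ℝ - b₁ * u₁ * (u₁ - u₂) + a₁ * φ₁ * (u₁ - u₂)) -
      (⟪-G₂ + φ₂ • W₂, G₁ - G₂⟫_ℝ - b₂ * u₂ * (u₁ - u₂) + a₂ * φ₂ * (u₁ - u₂))) +
      ‖G₁ - G₂‖ ^ 2 ≤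
      (2 * L ^ 2 * ν ^ 2 + 2 * A * L + 2) * (u₁ - u₂) ^ 2 +
        (2 * K ^ 2 * dV ^ 2 + K ^ 2 * da ^ 2) + db ^ 2 * u₂ ^ 2 := by
  have hK : 0 ≤ K := (abs_nonneg _).trans hφ₁
  have hν : 0 ≤ ν := (norm_nonneg _).trans hW
  have hA : 0 ≤ A := (abs_nonneg _).trans ha₂
  set v := u₁ - u₂ with hv
  set G := G₁ - G₂ with hG
  -- Only W₁ is multiplied by the difference of the φ's, so no bound on W₂ is needed.
  have split : ⟪-G₁ + φ₁ • W₁, G⟫_ℝ - ⟪-G₂ + φ₂ • W₂, G⟫_ℝ =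
      -‖G‖ ^ 2 + ⟪(φ₁ - φ₂) • W₁, G⟫_ℝ + ⟪φ₂ • (W₁ - W₂), G⟫_ℝ := by
    rw [← real_inner_self_eq_norm_sq, ← inner_neg_left, ← inner_add_left, ← inner_add_left,
      ← inner_sub_left, hG, sub_smul, smul_sub]
    congr 1
    abel
  have e1 : ‖(φ₁ - φ₂) • W₁‖ ≤ L * |v| * ν := by
    rw [norm_smul]
    exact mul_le_mul hφ hW (norm_nonneg _) (by positivity)
  -- The two drift terms share the one free ‖G‖², hence ε = 1/2 for each.
  have h1 := two_mul_mul_le_of_abs_le (abs_inner_le_mul (y := G) e1) (1 / 2) (by norm_num)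
    (r := 2 * (L * |v| * ν) ^ 2) (by linarith)
  have e2 : ‖φ₂ • (W₁ - W₂)‖ ≤ K * dV := by
    rw [norm_smul]
    exact mul_le_mul hφ₂ hdW (norm_nonneg _) hK
  have h2 := two_mul_mul_le_of_abs_le (abs_inner_le_mul (y := G) e2) (1 / 2) (by norm_num)
    (r := 2 * (K * dV) ^ 2) (by linarith)
  have e3 : |-((b₁ - b₂) * u₂ * v)| ≤ (db * |u₂|) * |v| := by
    rw [abs_neg, abs_mul, abs_mul]
    gcongr
  have h3 := two_mul_mul_le_of_abs_le e3 1 one_pos (r := (db * |u₂|) ^ 2) (by simp)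
  have e4 : |(a₁ - a₂) * φ₁ * v| ≤ (da * K) * |v| := by
    rw [abs_mul, abs_mul]
    have := abs_nonneg (a₁ - a₂)
    gcongr
    linarith
  have h4 := two_mul_mul_le_of_abs_le e4 1 one_pos (r := (da * K) ^ 2) (by simp)
  have h5 : a₂ * (φ₁ - φ₂) * v ≤ A * L * v ^ 2 := by
    refine (le_abs_self _).trans ?_
    rw [abs_mul, abs_mul, ← sq_abs v]
    calc |a₂| * |φ₁ - φ₂| * |v| ≤ A * (L * |v|) * |v| := by gcongr
      _ = _ := by ring
  have h6 : 0 ≤ b₁ * v ^ 2 := by positivity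
  simp only [mul_pow, sq_abs, one_mul] at h1 h2 h3 h4
  -- b₁ enters only through a term of good sign and its difference from b₂; likewise the next
  -- splitting needs a bound only on a₂.
  have e : b₁ * u₁ * v - b₂ * u₂ * v = b₁ * v ^ 2 + (b₁ - b₂) * u₂ * v := by rw [hv]; ring
  have e' : a₁ * φ₁ * v - a₂ * φ₂ * v = (a₁ - a₂) * φ₁ * v + a₂ * (φ₁ - φ₂) * v := by ring
  linarith

theorem energy_at_time (hf : IsAdmissibleMobility L K f) {a b : Space N → ℝ}
    (ham : IsBoundedCoeff D a) (hbm : IsBoundedCoeff D b) {V : W1 D ∞} {u : H1 D} {ν A : ℝ}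
    (ha : ∀ᵐ x ∂(vol D), |a x| ≤ A) (hb : ∀ᵐ x ∂(vol D), 0 ≤ b x)
    (hV : ∀ᵐ x ∂(vol D), ‖grad V x‖ ≤ ν) :
    2 * (∫ x in D, weakIntegrand f a b V u u x) + ‖grad u‖ ^ 2 ≤
      ‖fn u‖ ^ 2 + K ^ 2 * (ν ^ 2 + A ^ 2) * (vol D).real univ := by
  have i1 := integrable_weakIntegrand hf ham hbm V u u
  have i2 := integrable_norm_sq_Lp_two (grad u)
  have i3 := integrable_norm_sq_Lp_two (fn u)
  have i4 : Integrable (fun _ : Space N => K ^ 2 * (ν ^ 2 + A ^ 2)) (vol D) := integrable_const _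
  have hm := integral_mono_ae ((i1.const_mul 2).add i2) (i3.add i4) (by
    filter_upwards [ha, hb, hV] with x h1 h2 h3
    have := two_mul_energy_density_le (G := grad u x) (u := fn u x) (hf.bounded (fn u x)) h3 h1 h2
    simpa [weakIntegrand] using this)
  simp only [Pi.add_apply] at hm
  rw [integral_add (i1.const_mul 2) i2, integral_add i3 i4, integral_const_mul,
    ← norm_sq_Lp_two_eq_integral, ← norm_sq_Lp_two_eq_integral, integral_const, smul_eq_mul] at hm
  linarith

/-- The differences of a and V meet factors bounded by K, which costs |D| on integration. The
difference of b meets u₂, for which only an L² bound is available. -/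
theorem difference_at_time (hf : IsAdmissibleMobility L K f) {a₁ a₂ b₁ b₂ : Space N → ℝ}
    (ham₁ : IsBoundedCoeff D a₁) (ham₂ : IsBoundedCoeff D a₂) (hbm₁ : IsBoundedCoeff D b₁)
    (hbm₂ : IsBoundedCoeff D b₂) {V₁ V₂ : W1 D ∞} {u₁ u₂ : H1 D} {ν A dV da db : ℝ}
    (ha₂ : ∀ᵐ x ∂(vol D), |a₂ x| ≤ A) (hda : ∀ᵐ x ∂(vol D), |a₁ x - a₂ x| ≤ da)
    (hb₁ : ∀ᵐ x ∂(vol D), 0 ≤ b₁ x) (hdb : ∀ᵐ x ∂(vol D), |b₁ x - b₂ x| ≤ db)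
    (hV : ∀ᵐ x ∂(vol D), ‖grad V₁ x‖ ≤ ν)
    (hdV : ∀ᵐ x ∂(vol D), ‖grad V₁ x - grad V₂ x‖ ≤ dV) :
    2 * ((∫ x in D, weakIntegrand f a₁ b₁ V₁ u₁ (u₁ - u₂) x) -
      ∫ x in D, weakIntegrand f a₂ b₂ V₂ u₂ (u₁ - u₂) x) + ‖grad (u₁ - u₂)‖ ^ 2 ≤
      (2 * L ^ 2 * ν ^ 2 + 2 * A * L + 2) * ‖fn (u₁ - u₂)‖ ^ 2 +
        ((2 * K ^ 2 * dV ^ 2 + K ^ 2 * da ^ 2) * (vol D).real univ + db ^ 2 * ‖fn u₂‖ ^ 2) := by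
  have i1 := integrable_weakIntegrand hf ham₁ hbm₁ V₁ u₁ (u₁ - u₂)
  have i1' := integrable_weakIntegrand hf ham₂ hbm₂ V₂ u₂ (u₁ - u₂)
  have i2 := integrable_norm_sq_Lp_two (grad (u₁ - u₂))
  have i3 := (integrable_norm_sq_Lp_two (fn (u₁ - u₂))).const_mul
    (2 * L ^ 2 * ν ^ 2 + 2 * A * L + 2)
  have i4 : Integrable (fun _ : Space N => 2 * K ^ 2 * dV ^ 2 + K ^ 2 * da ^ 2) (vol D) :=
    integrable_const _
  have i5 := (integrable_norm_sq_Lp_two (fn u₂)).const_mul (db ^ 2)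
  have hm := integral_mono_ae (((i1.sub i1').const_mul 2).add i2) ((i3.add i4).add i5) (by
    filter_upwards [ha₂, hda, hb₁, hdb, hV, hdV, Lp.coeFn_sub (fn u₁) (fn u₂),
      Lp.coeFn_sub (grad u₁) (grad u₂)] with x h1 h2 h3 h4 h5 h6 h7 h8
    have hLip : |f (fn u₁ x) - f (fn u₂ x)| ≤ L * |fn u₁ x - fn u₂ x| := by
      simpa [Real.dist_eq] using hf.lipschitz.dist_le_mul (fn u₁ x) (fn u₂ x)
    have := two_mul_difference_density_le (G₁ := grad u₁ x) (G₂ := grad u₂ x)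
      (hf.bounded (fn u₁ x)) (hf.bounded (fn u₂ x)) L.2 hLip h5 h6 h1 h2 h3 h4
    simp only [Pi.add_apply, Pi.sub_apply, weakIntegrand, fn_sub, grad_sub, h7, h8,
      Real.norm_eq_abs, sq_abs]
    exact this)
  rw [integral_add' ((i1.sub i1').const_mul 2) i2, integral_add' (i3.add i4) i5,
    integral_add' i3 i4, integral_const_mul, integral_const_mul, integral_const_mul,
    integral_sub' i1 i1', ← norm_sq_Lp_two_eq_integral, ← norm_sq_Lp_two_eq_integral,
    ← norm_sq_Lp_two_eq_integral, integral_const, smul_eq_mul] at hm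
  linarith

end FixedTime

end ConvDiff

theorem integral_deriv_mul_inner_sub {H E : Type*} [NormedAddCommGroup H] [NormedSpace ℝ H]
    [NormedAddCommGroup E] [InnerProductSpace ℝ E] (ι : H →L[ℝ] E) {s : Set ℝ}
    [IsFiniteMeasure (volume.restrict s)] {v₁ v₂ v : ℝ → H} {w₁ w₂ w : ℝ → (H →L[ℝ] ℝ)}
    (hv₁ : MemLp v₁ 2 (volume.restrict s)) (hv₂ : MemLp v₂ 2 (volume.restrict s))
    (hw₁ : MemLp w₁ 2 (volume.restrict s)) (hw₂ : MemLp w₂ 2 (volume.restrict s))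
    (hv : ∀ᵐ t ∂volume.restrict s, v t = v₁ t - v₂ t)
    (hw : ∀ᵐ t ∂volume.restrict s, w t = w₁ t - w₂ t) (φ : H) {η : ℝ → ℝ} (h1 : ContDiff ℝ ∞ η)
    (h2 : HasCompactSupport η)
    (e₁ : ∫ t in s, deriv η t * ⟪ι (v₁ t), ι φ⟫_ℝ = - ∫ t in s, η t * w₁ t φ)
    (e₂ : ∫ t in s, deriv η t * ⟪ι (v₂ t), ι φ⟫_ℝ = - ∫ t in s, η t * w₂ t φ) :
    ∫ t in s, deriv η t * ⟪ι (v t), ι φ⟫_ℝ = - ∫ t in s, η t * w t φ := by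
  have iu : ∀ u : ℝ → H, MemLp u 2 (volume.restrict s) →
      IntegrableOn (fun t => ⟪ι (u t), ι φ⟫_ℝ) s := fun u hu =>
    ((ι.comp_memLp' hu).integrable (by norm_num)).inner_const _
  have iw : ∀ w : ℝ → (H →L[ℝ] ℝ), MemLp w 2 (volume.restrict s) →
      IntegrableOn (fun t => w t φ) s :=
    fun w hw => (hw.integrable (by norm_num)).apply_continuousLinearMap φ
  have hd1 : Continuous (deriv η) := h1.continuous_deriv (by simp)
  have hd2 : HasCompactSupport (deriv η) := h2.deriv
  have a1 : (fun t => deriv η t * ⟪ι (v t), ι φ⟫_ℝ) =ᵐ[volume.restrict s] fun t =>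
      deriv η t * ⟪ι (v₁ t), ι φ⟫_ℝ - deriv η t * ⟪ι (v₂ t), ι φ⟫_ℝ := by
    filter_upwards [hv] with t ht
    rw [ht, map_sub, inner_sub_left, mul_sub]
  have a2 : (fun t => η t * w t φ) =ᵐ[volume.restrict s] fun t =>
      η t * w₁ t φ - η t * w₂ t φ := by
    filter_upwards [hw] with t ht
    rw [ht, _root_.sub_apply, mul_sub]
  have b : ∀ u, MemLp u 2 (volume.restrict s) →
      IntegrableOn (fun t => deriv η t * ⟪ι (u t), ι φ⟫_ℝ) s := fun u hu =>
    integrableOn_smul_of_test (iu u hu) hd1 hd2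
  have c : ∀ w : ℝ → (H →L[ℝ] ℝ), MemLp w 2 (volume.restrict s) → IntegrableOn (fun t => η t * w t φ) s :=
    fun w hw => integrableOn_smul_of_test (iw w hw) h1.continuous h2
  rw [integral_congr_ae a1, integral_congr_ae a2, integral_sub (b v₁ hv₁) (b v₂ hv₂),
    integral_sub (c w₁ hw₁) (c w₂ hw₂), e₁, e₂]
  ring

theorem ae_dual_sub_apply {H : Type*} [NormedAddCommGroup H] [NormedSpace ℝ H] {μ : Measure ℝ}
    {p : ℝ≥0∞} (w₁ w₂ : Lp (H →L[ℝ] ℝ) p μ) :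
    ∀ᵐ t ∂μ, ∀ φ, (w₁ - w₂) t φ = w₁ t φ - w₂ t φ := by
  filter_upwards [Lp.coeFn_sub w₁ w₂] with t ht φ
  rw [ht]
  rfl

/-! ### Estimates for weak solutions in time. -/

namespace ConvDiff

section Evolution

variable {N : ℕ} {D : Set (Space N)} {T : ℝ}

theorem IsBoundedLipschitzDomain.isFiniteMeasure_vol (hD : IsBoundedLipschitzDomain D) :
    IsFiniteMeasure (vol D) :=
  ⟨by rw [Measure.restrict_apply_univ]; exact hD.isBounded.measure_lt_top⟩

theorem integral_fn_mul_fn (u φ : H1 D) :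
    ∫ x in D, fn u x * fn φ x = ⟪fnL D 2 u, fnL D 2 φ⟫_ℝ := by
  rw [L2.inner_def, fnL_apply, fnL_apply]
  refine integral_congr_ae (ae_of_all _ fun x => ?_)
  simp [mul_comm]

theorem IsTimeDerivative.integral_deriv_mul_inner {u : Lp (H1 D) 2 (timeVol T)}
    {w : Lp (H1 D →L[ℝ] ℝ) 2 (timeVol T)} (h : IsTimeDerivative u w) (φ : H1 D) (η : ℝ → ℝ)
    (h1 : ContDiff ℝ ∞ η) (h2 : HasCompactSupport η) (h3 : tsupport η ⊆ Ioo 0 T) :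
    ∫ t in Ioo 0 T, deriv η t * ⟪fnL D 2 (u t), fnL D 2 φ⟫_ℝ
      = - ∫ t in Ioo 0 T, η t * w t φ := by
  simp only [← integral_fn_mul_fn]
  exact h φ η h1 h2 h3

theorem IsTimeDerivative.sub {u₁ u₂ : Lp (H1 D) 2 (timeVol T)}
    {w₁ w₂ : Lp (H1 D →L[ℝ] ℝ) 2 (timeVol T)} (h₁ : IsTimeDerivative u₁ w₁)
    (h₂ : IsTimeDerivative u₂ w₂) : IsTimeDerivative (u₁ - u₂) (w₁ - w₂) := by
  intro φ η h1 h2 h3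
  simp only [integral_fn_mul_fn]
  exact integral_deriv_mul_inner_sub (fnL D 2) (Lp.memLp u₁) (Lp.memLp u₂) (Lp.memLp w₁)
    (Lp.memLp w₂) (Lp.coeFn_sub u₁ u₂) (Lp.coeFn_sub w₁ w₂) φ h1 h2
    (h₁.integral_deriv_mul_inner φ η h1 h2 h3) (h₂.integral_deriv_mul_inner φ η h1 h2 h3)

theorem ae_isBoundedCoeff_slice (a : Lp ℝ ∞ (cylVol T D)) :
    ∀ᵐ t ∂(timeVol T), IsBoundedCoeff D fun x => a (t, x) := by
  filter_upwards [ae_aestronglyMeasurable_slice a, ae_ae_abs_slice_le a] with t h1 h2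
  exact ⟨h1, _, h2⟩

/-- The weak formulation holds at almost every time for all test functions simultaneously. -/
theorem IsWeakSolution.exists_timeDerivative [IsFiniteMeasure (vol D)] {f : ℝ → ℝ} {L : ℝ≥0}
    {K : ℝ} (hf : IsAdmissibleMobility L K f) {α β : Lp ℝ ∞ (cylVol T D)}
    {V : Lp (W1 D ∞) ∞ (timeVol T)} {u₀ : Lp ℝ 2 (vol D)} {u : Lp (H1 D) 2 (timeVol T)}
    (h : IsWeakSolution f α β V u₀ u) :
    ∃ w : Lp (H1 D →L[ℝ] ℝ) 2 (timeVol T), IsTimeDerivative u w ∧ ∀ᵐ t ∂(timeVol T), ∀ φ : H1 D,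
      w t φ = ∫ x in D,
        weakIntegrand f (fun x => α (t, x)) (fun x => β (t, x)) (V t) (u t) φ x := by
  obtain ⟨w, hw, hweak⟩ := h.weak_form
  refine ⟨w, hw, ?_⟩
  have := separableSpace_H1 (D := D)
  have key := ae_forall_eq_zero (μ := timeVol T) (Φ := fun t (φ : H1 D) => w t φ - ∫ x in D,
    weakIntegrand f (fun x => α (t, x)) (fun x => β (t, x)) (V t) (u t) φ x) ?_ ?_
  · filter_upwards [key] with t ht φ using sub_eq_zero.1 (ht φ)
  · filter_upwards [ae_isBoundedCoeff_slice α, ae_isBoundedCoeff_slice β] with t ha hb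
    exact (w t).continuous.sub (continuous_integral_weakIntegrand hf ha hb (V t) (u t))
  · intro φ
    filter_upwards [ae_isBoundedCoeff_slice α, ae_isBoundedCoeff_slice β, hweak φ] with t ha hb ht
    rw [integral_weakIntegrand hf ha hb]
    linarith

/-- `parabolic_energy_estimate` with dissipation ‖∇v‖². The factor 4 comes from squaring the ℓ¹-type
H¹ norm, (p + q)² ≤ 2p² + 2q², and from bounding both integrals by the same quantity. -/
theorem evolution_estimate (hT : 0 < T) {v : Lp (H1 D) 2 (timeVol T)}
    {w : Lp (H1 D →L[ℝ] ℝ) 2 (timeVol T)} (hw : IsTimeDerivative v w) {v₀ : Lp ℝ 2 (vol D)}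
    (h0 : Tendsto (fun t => fn (v t)) (ae (timeVol T) ⊓ 𝓝 0) (𝓝 v₀)) {a B : ℝ} (ha : 1 ≤ a)
    (hB : 0 ≤ B) (h : ∀ᵐ t ∂(timeVol T),
      2 * w t (v t) + ‖grad (v t)‖ ^ 2 ≤ a * ‖fn (v t)‖ ^ 2 + B) :
    (∀ᵐ t ∂(timeVol T), ‖fn (v t)‖ ^ 2 ≤ (‖v₀‖ ^ 2 + B) * Real.exp (a * T)) ∧
      ‖v‖ ^ 2 ≤ 4 * ((‖v₀‖ ^ 2 + B) * Real.exp (a * T)) := by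
  have iP : IntegrableOn (fun t => ‖grad (v t)‖ ^ 2) (Ioo 0 T) :=
    ((gradL D 2).comp_memLp v).norm.integrable_sq
  have iF : IntegrableOn (fun t => ‖fn (v t)‖ ^ 2) (Ioo 0 T) :=
    ((fnL D 2).comp_memLp v).norm.integrable_sq
  obtain ⟨h1, h2, h3⟩ := parabolic_energy_estimate (fnL D 2) hT (Lp.memLp v) (Lp.memLp w)
    hw.integral_deriv_mul_inner h0 iP (fun t => sq_nonneg _) ha hB h
  refine ⟨h1, ?_⟩
  rw [norm_sq_Lp_two_eq_integral]
  have hm : ∫ t in Ioo 0 T, ‖v t‖ ^ 2 ≤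
      ∫ t in Ioo 0 T, (2 * ‖fn (v t)‖ ^ 2 + 2 * ‖grad (v t)‖ ^ 2) := by
    refine integral_mono (integrable_norm_sq_Lp_two v)
      ((iF.const_mul 2).add (iP.const_mul 2)) fun t => ?_
    simp only
    rw [norm_W1_eq]
    nlinarith [sq_nonneg (‖fn (v t)‖ - ‖grad (v t)‖)]
  rw [integral_add (iF.const_mul 2) (iP.const_mul 2), integral_const_mul, integral_const_mul] at hm
  simp only [fnL_apply] at h2
  linarith

theorem norm_sq_le_of_isAdmissibleInitial {p : ℝ} {u₀ : Lp ℝ 2 (vol D)} [IsFiniteMeasure (vol D)]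
    (h : IsAdmissibleInitial D p u₀) : ‖u₀‖ ^ 2 ≤ (vol D).real univ := by
  rw [norm_sq_Lp_two_eq_integral]
  have := integral_mono_ae (integrable_norm_sq_Lp_two u₀) (integrable_const (1 : ℝ)) (by
    filter_upwards [h.nonneg, h.le_one] with x h1 h2
    rw [Real.norm_eq_abs, sq_abs]
    nlinarith)
  simpa using this

/-- The energy estimate for a single weak solution. -/
theorem IsWeakSolution.energy_estimate [IsFiniteMeasure (vol D)] (hT : 0 < T) {f : ℝ → ℝ}
    {L : ℝ≥0} {K : ℝ} (hf : IsAdmissibleMobility L K f) {α β : Lp ℝ ∞ (cylVol T D)}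
    {V : Lp (W1 D ∞) ∞ (timeVol T)} {u₀ : Lp ℝ 2 (vol D)} {u : Lp (H1 D) 2 (timeVol T)}
    (h : IsWeakSolution f α β V u₀ u) (hβ : IsUniformlyPositive β) {p : ℝ}
    (h0 : IsAdmissibleInitial D p u₀) :
    (∀ᵐ t ∂(timeVol T), ‖fn (u t)‖ ^ 2 ≤
      (vol D).real univ * (1 + K ^ 2 * (‖V‖ ^ 2 + ‖α‖ ^ 2)) * Real.exp T) ∧
      ‖u‖ ^ 2 ≤ 4 * ((vol D).real univ * (1 + K ^ 2 * (‖V‖ ^ 2 + ‖α‖ ^ 2)) * Real.exp T) := by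
  obtain ⟨w, hw, hweak⟩ := h.exists_timeDerivative hf
  have hB : 0 ≤ K ^ 2 * (‖V‖ ^ 2 + ‖α‖ ^ 2) * (vol D).real univ := by positivity
  -- Here the Grönwall rate is 1, whence the factor exp T. The absorption term has a good sign, so
  -- the norm of β does not appear.
  obtain ⟨h1, h2⟩ := evolution_estimate hT hw h.initial le_rfl hB (by
    filter_upwards [hweak, ae_isBoundedCoeff_slice α, ae_isBoundedCoeff_slice β,
      ae_ae_abs_slice_le α, hβ.ae_ae_nonneg, ae_ae_norm_grad_le V] with t k1 k2 k3 k4 k5 k6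
    rw [k1, one_mul]
    exact energy_at_time hf k2 k3 k4 k5 k6)
  have hle : (‖u₀‖ ^ 2 + K ^ 2 * (‖V‖ ^ 2 + ‖α‖ ^ 2) * (vol D).real univ) * Real.exp (1 * T) ≤
      (vol D).real univ * (1 + K ^ 2 * (‖V‖ ^ 2 + ‖α‖ ^ 2)) * Real.exp T := by
    rw [one_mul]
    gcongr
    linarith [norm_sq_le_of_isAdmissibleInitial h0]
  exact ⟨h1.mono fun t ht => ht.trans hle, h2.trans (by linarith)⟩

set_option maxHeartbeats 1000000 in
/-- The stability estimate for two weak solutions, in terms of a bound for the second one. -/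
theorem IsWeakSolution.difference_estimate [IsFiniteMeasure (vol D)] (hT : 0 < T) {f : ℝ → ℝ}
    {L : ℝ≥0} {K M S : ℝ} (hf : IsAdmissibleMobility L K f) {α₁ α₂ β₁ β₂ : Lp ℝ ∞ (cylVol T D)}
    {V₁ V₂ : Lp (W1 D ∞) ∞ (timeVol T)} {u₁₀ u₂₀ : Lp ℝ 2 (vol D)}
    {u₁ u₂ : Lp (H1 D) 2 (timeVol T)} (hβ₁ : IsUniformlyPositive β₁) (hV₁ : ‖V₁‖ ≤ M)
    (hα₂ : ‖α₂‖ ≤ M) (h₁ : IsWeakSolution f α₁ β₁ V₁ u₁₀ u₁)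
    (h₂ : IsWeakSolution f α₂ β₂ V₂ u₂₀ u₂) (hS0 : 0 ≤ S)
    (hS : ∀ᵐ t ∂(timeVol T), ‖fn (u₂ t)‖ ^ 2 ≤ S) :
    ‖u₁ - u₂‖ ^ 2 ≤ 4 * ((‖u₁₀ - u₂₀‖ ^ 2 +
      ((2 * K ^ 2 * ‖V₁ - V₂‖ ^ 2 + K ^ 2 * ‖α₁ - α₂‖ ^ 2) * (vol D).real univ +
        ‖β₁ - β₂‖ ^ 2 * S)) * Real.exp ((2 * L ^ 2 * M ^ 2 + 2 * M * L + 2) * T)) := by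
  obtain ⟨w₁, hw₁, hweak₁⟩ := h₁.exists_timeDerivative hf
  obtain ⟨w₂, hw₂, hweak₂⟩ := h₂.exists_timeDerivative hf
  have hM : 0 ≤ M := (norm_nonneg V₁).trans hV₁
  have hsu : ∀ᵐ t ∂(timeVol T), (u₁ - u₂) t = u₁ t - u₂ t := Lp.coeFn_sub u₁ u₂
  have hinit : Tendsto (fun t => fn ((u₁ - u₂) t)) (ae (timeVol T) ⊓ 𝓝 0) (𝓝 (u₁₀ - u₂₀)) := by
    refine (h₁.initial.sub h₂.initial).congr' ?_
    filter_upwards [hsu.filter_mono inf_le_left] with t ht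
    exact ((congrArg fn ht).trans (fn_sub _ _)).symm
  have ha : (1 : ℝ) ≤ 2 * L ^ 2 * M ^ 2 + 2 * M * L + 2 := by
    have : (0 : ℝ) ≤ 2 * L ^ 2 * M ^ 2 + 2 * M * L := by positivity
    linarith
  have hpt : ∀ᵐ t ∂(timeVol T), 2 * (w₁ t (u₁ t - u₂ t) - w₂ t (u₁ t - u₂ t)) +
      ‖grad (u₁ t - u₂ t)‖ ^ 2 ≤
      (2 * L ^ 2 * M ^ 2 + 2 * M * L + 2) * ‖fn (u₁ t - u₂ t)‖ ^ 2 +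
        ((2 * K ^ 2 * ‖V₁ - V₂‖ ^ 2 + K ^ 2 * ‖α₁ - α₂‖ ^ 2) * (vol D).real univ +
        ‖β₁ - β₂‖ ^ 2 * S) := by
    filter_upwards [hweak₁, hweak₂, ae_isBoundedCoeff_slice α₁, ae_isBoundedCoeff_slice α₂,
      ae_isBoundedCoeff_slice β₁, ae_isBoundedCoeff_slice β₂, ae_ae_abs_slice_le α₂,
      ae_ae_abs_slice_sub_le α₁ α₂, hβ₁.ae_ae_nonneg, ae_ae_abs_slice_sub_le β₁ β₂,
      ae_ae_norm_grad_le V₁, ae_ae_norm_grad_sub_le V₁ V₂, hS]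
      with t e3 e4 k1 k2 k3 k4 k5 k6 k7 k8 k9 k10 k11
    rw [e3, e4]
    have k5' : ∀ᵐ x ∂(vol D), |α₂ (t, x)| ≤ M := k5.mono fun x hx => hx.trans hα₂
    have k9' : ∀ᵐ x ∂(vol D), ‖grad (V₁ t) x‖ ≤ M := k9.mono fun x hx => hx.trans hV₁
    refine (difference_at_time hf k1 k2 k3 k4 k5' k6 k7 k8 k9' k10).trans ?_
    gcongr
  have hpt' : ∀ᵐ t ∂(timeVol T), 2 * (w₁ - w₂) t ((u₁ - u₂) t) + ‖grad ((u₁ - u₂) t)‖ ^ 2 ≤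
      (2 * L ^ 2 * M ^ 2 + 2 * M * L + 2) * ‖fn ((u₁ - u₂) t)‖ ^ 2 +
        ((2 * K ^ 2 * ‖V₁ - V₂‖ ^ 2 + K ^ 2 * ‖α₁ - α₂‖ ^ 2) * (vol D).real univ +
        ‖β₁ - β₂‖ ^ 2 * S) := by
    filter_upwards [hpt, hsu, ae_dual_sub_apply w₁ w₂] with t h e1 e2
    rw [e1, e2]
    exact h
  exact (evolution_estimate hT (hw₁.sub hw₂) hinit ha (by positivity) hpt').2

end Evolution

end ConvDiff

/-! ### Absorbing the constants and the final dichotomy. -/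

namespace ConvDiff

theorem norm_sq_le_of_norm_le {X F : Type*} [MeasurableSpace X] {μ : Measure X}
    [NormedAddCommGroup F] {p : ℝ≥0∞} [Fact (1 ≤ p)] {x y : Lp F p μ} {M : ℝ} (hx : ‖x‖ ≤ M) : ‖y‖ ^ 2 ≤ 2 * M ^ 2 + 2 * ‖x - y‖ ^ 2 := by
  have h : ‖y‖ ≤ M + ‖x - y‖ := by
    have := norm_sub_norm_le y x
    rw [norm_sub_rev] at this
    linarith
  nlinarith [sq_nonneg (M - ‖x - y‖), norm_nonneg y]

/-- The constant of the stability estimate, in terms of `m = |D|`, `K` and `M`. -/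
noncomputable def stabilityConst (m K M : ℝ) : ℝ := 64 * (1 + m * (1 + K ^ 2 + K ^ 2 * M ^ 2))

theorem stabilityConst_pos {m : ℝ} (hm : 0 ≤ m) (K M : ℝ) : 0 < stabilityConst m K M := by
  unfold stabilityConst
  positivity

/-- The coefficients, up to numerical factors, of the initial data, of the α and V differences, and
of the β difference; 64 leaves room for both cases of the dichotomy. -/
theorem stabilityConst_bounds {m : ℝ} (hm : 0 ≤ m) (K M : ℝ) :
    64 ≤ stabilityConst m K M ∧ 64 * (m * K ^ 2) ≤ stabilityConst m K M ∧
      64 * (m * (1 + K ^ 2 * (3 * M ^ 2 + 2))) ≤ 3 * stabilityConst m K M := by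
  unfold stabilityConst
  have hmk : 0 ≤ m * K ^ 2 := by positivity
  have hmq : 0 ≤ m * (K ^ 2 * M ^ 2) := by positivity
  exact ⟨by linarith, by linarith, by linarith⟩

/-- Absorbing the constants when the second potential is controlled. -/
theorem stability_arithmetic_of_bounded {m K M x y z r a T : ℝ} (hm : 0 ≤ m) (hx : 0 ≤ x)
    (hy : 0 ≤ y) (hz : 0 ≤ z) (hr : 0 ≤ r) (hT : 0 < T) :
    4 * ((r + ((2 * K ^ 2 * x + K ^ 2 * y) * m +
      z * (m * (1 + K ^ 2 * (3 * M ^ 2 + 2)) * Real.exp T))) * Real.exp ((a + 2) * T)) ≤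
      stabilityConst m K M * Real.exp ((a + 3) * T) * (y + z + x + r) := by
  obtain ⟨c1, c2, c3⟩ := stabilityConst_bounds hm K M
  have hc := (stabilityConst_pos hm K M).le
  set c := stabilityConst m K M
  -- The rate a + 2 comes from the difference estimate, the extra 1 from the growth of u₂.
  have hexp : Real.exp ((a + 3) * T) = Real.exp T * Real.exp ((a + 2) * T) := by
    rw [← Real.exp_add]
    ring_nf
  have hE1 : 1 ≤ Real.exp T := Real.one_le_exp hT.le
  have hE' : 0 ≤ Real.exp ((a + 2) * T) := (Real.exp_pos _).le
  rw [hexp]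
  set E := Real.exp T
  have hin : 4 * (r + ((2 * K ^ 2 * x + K ^ 2 * y) * m +
      z * (m * (1 + K ^ 2 * (3 * M ^ 2 + 2))))) ≤ c * (y + z + x + r) := by
    have k1 := mul_le_mul_of_nonneg_right c1 hr
    have k2 := mul_le_mul_of_nonneg_right c2 hx
    have k3 := mul_le_mul_of_nonneg_right c2 hy
    have k4 := mul_le_mul_of_nonneg_right c3 hz
    have k5 : 0 ≤ c * r := by positivity
    have k6 : 0 ≤ c * x := by positivity
    have k7 : 0 ≤ c * y := by positivity
    have k8 : 0 ≤ c * z := by positivity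
    linarith
  have hp : 0 ≤ r + (2 * K ^ 2 * x + K ^ 2 * y) * m := by positivity
  have hpE := le_mul_of_one_le_right hp hE1
  have hout : 4 * (r + ((2 * K ^ 2 * x + K ^ 2 * y) * m +
      z * (m * (1 + K ^ 2 * (3 * M ^ 2 + 2)) * E))) ≤ c * (y + z + x + r) * E :=
    le_trans (by linarith) (mul_le_mul_of_nonneg_right hin (by linarith))
  linarith [mul_le_mul_of_nonneg_right hout hE']

/-- Absorbing the constants when the potentials are far apart. -/
theorem stability_arithmetic_of_one_le {m K M x y z r a T V₁ V₂ α₁ α₂ : ℝ} (hm : 0 ≤ m)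
    (hx : 1 ≤ x) (hy : 0 ≤ y) (hz : 0 ≤ z) (hr : 0 ≤ r) (hT : 0 < T) (ha : 0 ≤ a)
    (hV₁ : V₁ ≤ M ^ 2) (hα₁ : α₁ ≤ 2 * M ^ 2 + 2 * y) (hV₂ : V₂ ≤ 2 * M ^ 2 + 2 * x)
    (hα₂ : α₂ ≤ M ^ 2) :
    2 * (4 * (m * (1 + K ^ 2 * (V₁ + α₁)) * Real.exp T)) +
      2 * (4 * (m * (1 + K ^ 2 * (V₂ + α₂)) * Real.exp T)) ≤
      stabilityConst m K M * Real.exp ((a + 3) * T) * (y + z + x + r) := by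
  obtain ⟨c1, c2, c3⟩ := stabilityConst_bounds hm K M
  have hc := (stabilityConst_pos hm K M).le
  set c := stabilityConst m K M
  have hx0 : 0 ≤ x := by linarith
  have hexp : Real.exp T ≤ Real.exp ((a + 3) * T) := Real.exp_le_exp.2 (by nlinarith)
  have hin : 8 * (m * (1 + K ^ 2 * (V₁ + α₁))) + 8 * (m * (1 + K ^ 2 * (V₂ + α₂))) ≤
      c * (y + z + x + r) := by
    have h1 : 8 * (m * (1 + K ^ 2 * (V₁ + α₁))) + 8 * (m * (1 + K ^ 2 * (V₂ + α₂))) ≤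
        8 * (m * (1 + K ^ 2 * (M ^ 2 + (2 * M ^ 2 + 2 * y)))) +
        8 * (m * (1 + K ^ 2 * (2 * M ^ 2 + 2 * x + M ^ 2))) := by gcongr
    refine h1.trans ?_
    have k1 := mul_le_mul_of_nonneg_right c2 hx0
    have k2 := mul_le_mul_of_nonneg_right c2 hy
    -- Since x ≥ 1, the terms containing no difference of data are absorbed too.
    have k3 : c ≤ c * x := le_mul_of_one_le_right hc hx
    have k4 : 0 ≤ c * r := by positivity
    have k5 : 0 ≤ c * z := by positivity
    have k6 : 0 ≤ c * y := by positivity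
    have k7 : 0 ≤ m * K ^ 2 := by positivity
    linarith
  have hpos : 0 ≤ c * (y + z + x + r) := by positivity
  calc _ = (8 * (m * (1 + K ^ 2 * (V₁ + α₁))) + 8 * (m * (1 + K ^ 2 * (V₂ + α₂)))) *
        Real.exp T := by ring
    _ ≤ c * (y + z + x + r) * Real.exp T :=
      mul_le_mul_of_nonneg_right hin (Real.exp_pos _).le
    _ ≤ c * (y + z + x + r) * Real.exp ((a + 3) * T) := mul_le_mul_of_nonneg_left hexp hpos
    _ = _ := by ring

theorem norm_sub_sq_le {X F : Type*} [MeasurableSpace X] {μ : Measure X} [NormedAddCommGroup F]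
    {p : ℝ≥0∞} [Fact (1 ≤ p)] (x y : Lp F p μ) :
    ‖x - y‖ ^ 2 ≤ 2 * ‖x‖ ^ 2 + 2 * ‖y‖ ^ 2 := by
  nlinarith [norm_sub_le x y, sq_nonneg (‖x‖ - ‖y‖), norm_nonneg (x - y)]

set_option maxHeartbeats 1000000 in
/-- The stability estimate with explicit constants. -/
theorem stability_estimate {N : ℕ} {D : Set (Space N)} [IsFiniteMeasure (vol D)] {T : ℝ}
    (hT : 0 < T) {f : ℝ → ℝ} {L : ℝ≥0} {K M p : ℝ} (hf : IsAdmissibleMobility L K f)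
    {α₁ α₂ β₁ β₂ : Lp ℝ ∞ (cylVol T D)} {V₁ V₂ : Lp (W1 D ∞) ∞ (timeVol T)}
    {u₁₀ u₂₀ : Lp ℝ 2 (vol D)} {u₁ u₂ : Lp (H1 D) 2 (timeVol T)} (hβ₁ : IsUniformlyPositive β₁)
    (hβ₂ : IsUniformlyPositive β₂) (hV₁ : ‖V₁‖ ≤ M) (hα₂ : ‖α₂‖ ≤ M)
    (h₁₀ : IsAdmissibleInitial D p u₁₀) (h₂₀ : IsAdmissibleInitial D p u₂₀)
    (h₁ : IsWeakSolution f α₁ β₁ V₁ u₁₀ u₁) (h₂ : IsWeakSolution f α₂ β₂ V₂ u₂₀ u₂) :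
    ‖u₁ - u₂‖ ^ 2 ≤ stabilityConst ((vol D).real univ) K M *
      Real.exp ((2 * L ^ 2 * M ^ 2 + 2 * M * L + 3) * T) *
        (‖α₁ - α₂‖ ^ 2 + ‖β₁ - β₂‖ ^ 2 + ‖V₁ - V₂‖ ^ 2 + ‖u₁₀ - u₂₀‖ ^ 2) := by
  have hM : 0 ≤ M := (norm_nonneg α₂).trans hα₂
  have hm : 0 ≤ (vol D).real univ := measureReal_nonneg
  have hV₂ : ‖V₂‖ ^ 2 ≤ 2 * M ^ 2 + 2 * ‖V₁ - V₂‖ ^ 2 := norm_sq_le_of_norm_le hV₁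
  have hα₁ : ‖α₁‖ ^ 2 ≤ 2 * M ^ 2 + 2 * ‖α₁ - α₂‖ ^ 2 := by
    rw [norm_sub_rev]
    exact norm_sq_le_of_norm_le hα₂
  have hV₁' : ‖V₁‖ ^ 2 ≤ M ^ 2 := pow_le_pow_left₀ (norm_nonneg V₁) hV₁ 2
  have hα₂' : ‖α₂‖ ^ 2 ≤ M ^ 2 := pow_le_pow_left₀ (norm_nonneg α₂) hα₂ 2
  obtain ⟨hS, hn₂⟩ := h₂.energy_estimate hT hf hβ₂ h₂₀
  obtain ⟨-, hn₁⟩ := h₁.energy_estimate hT hf hβ₁ h₁₀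
  -- M does not bound V₂. Potentials at distance at most 1 give ‖V₂‖² ≤ 2M² + 2; for distant ones no
  -- smallness is needed, and the two energy bounds are simply added.
  rcases le_total (‖V₁ - V₂‖ ^ 2) 1 with hx1 | hx1
  · have hSle : (vol D).real univ * (1 + K ^ 2 * (‖V₂‖ ^ 2 + ‖α₂‖ ^ 2)) * Real.exp T ≤
        (vol D).real univ * (1 + K ^ 2 * (3 * M ^ 2 + 2)) * Real.exp T := by
      have hsum : ‖V₂‖ ^ 2 + ‖α₂‖ ^ 2 ≤ 3 * M ^ 2 + 2 := by linarith
      gcongr _ * (1 + _ * ?_) * _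
    exact (h₁.difference_estimate hT hf hβ₁ hV₁ hα₂ h₂ (by positivity)
      (hS.mono fun t ht => ht.trans hSle)).trans
      (stability_arithmetic_of_bounded hm (sq_nonneg _) (sq_nonneg _) (sq_nonneg _) (sq_nonneg _)
        hT)
  · refine (norm_sub_sq_le u₁ u₂).trans (le_trans (add_le_add
      (mul_le_mul_of_nonneg_left hn₁ zero_le_two) (mul_le_mul_of_nonneg_left hn₂ zero_le_two)) ?_)
    exact stability_arithmetic_of_one_le hm hx1 (sq_nonneg _) (sq_nonneg _) (sq_nonneg _) hT
      (by positivity) hV₁' hα₁ hV₂ hα₂'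

end ConvDiff

open ConvDiff
theorem theorem3p3 (L : ℝ≥0) (M : ℝ) :
    ∃ Ctilde : ℝ, 0 < Ctilde ∧
    ∀ (N : ℕ), 1 ≤ N → N ≤ 3 →
    ∀ (D : Set (Space N)), IsBoundedLipschitzDomain D →
    ∀ K : ℝ,
    ∃ C : ℝ, 0 < C ∧
    ∀ (T : ℝ), 0 < T →
    ∀ (p : ℝ), 2 < p → p < 3 →
    ∀ (f : ℝ → ℝ), IsAdmissibleMobility L K f →
    ∀ (α₁ α₂ β₁ β₂ : Lp ℝ ∞ (cylVol T D)),
      IsUniformlyPositive α₁ → IsUniformlyPositive α₂ →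
      IsUniformlyPositive β₁ → IsUniformlyPositive β₂ →
    ∀ (V₁ V₂ : Lp (W1 D ∞) ∞ (timeVol T)),
      ‖V₁‖ ≤ M → ‖α₂‖ ≤ M → ‖β₂‖ ≤ M →
    ∀ (u₁₀ u₂₀ : Lp ℝ 2 (vol D)),
      IsAdmissibleInitial D p u₁₀ → IsAdmissibleInitial D p u₂₀ →
    ∀ (u₁ u₂ : Lp (H1 D) 2 (timeVol T)),
      IsWeakSolution f α₁ β₁ V₁ u₁₀ u₁ → IsWeakSolution f α₂ β₂ V₂ u₂₀ u₂ →
      ‖u₁ - u₂‖ ^ 2 ≤ C * Real.exp (Ctilde * T) *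
        (‖α₁ - α₂‖ ^ 2 + ‖β₁ - β₂‖ ^ 2 + ‖V₁ - V₂‖ ^ 2 + ‖u₁₀ - u₂₀‖ ^ 2) := by
  -- The witness precedes any data, so M ≥ 0 is not yet known; |M| keeps it positive and becomes M
  -- once ‖α₂‖ ≤ M is at hand.
  refine ⟨2 * L ^ 2 * M ^ 2 + 2 * |M| * L + 3, by positivity, ?_⟩
  intro N _ _ D hD K
  have := hD.isFiniteMeasure_vol
  refine ⟨stabilityConst ((vol D).real univ) K M, stabilityConst_pos measureReal_nonneg K M, ?_⟩
  intro T hT p _ _ f hf α₁ α₂ β₁ β₂ _ _ hβ₁ hβ₂ V₁ V₂ hV₁ hα₂ _ u₁₀ u₂₀ h₁₀ h₂₀ u₁ u₂ h₁ h₂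
  rw [abs_of_nonneg ((norm_nonneg α₂).trans hα₂)]
  exact stability_estimate hT hf hβ₁ hβ₂ hV₁ hα₂ h₁₀ h₂₀ h₁ h₂
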